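/- Let $d\nu(z)=\frac1\pi e^{-|z|^2}\,dz$ be the Gaussian measure on $\mathbb{C}$, and let the Segal–Bargmann–Fock space $\mathcal{F}^2(\mathbb{C})$ be the closed subspace of $L^2(\mathbb{C},\nu)$ consisting of the entire functions that are square-integrable with respect to $\nu$. Let $P:L^2(\mathbb{C},\nu)\to\mathcal{F}^2(\mathbb{C})$ be the orthogonal projection, and for $\sigma\in L^\infty(\mathbb{C},\nu)$ let $T_\sigma=PM_\sigma$ be the Toeplitz operator on $\mathcal{F}^2(\mathbb{C})$ with symbol $\sigma$, where $M_\sigma$ is multiplication by $\sigma$. Let $\mathcal{K}_N=\mathrm{span}\{z^n/\sqrt{n!}:n=0,\dots,N\}$, and let $P_N$ be the orthogonal projection of $\mathcal{F}^2(\mathbb{C})$ onto $\mathcal{K}_N$. The compression $P_NT_\sigma P_N$ is regarded as an operator on the $(N+1)$-dimensional space $\mathcal{K}_N$. For real-valued $\sigma$ it is self-adjoint; its eigenvalues, repeated according to multiplicity, are denoted $\lambda_j^N(\sigma)$, $0\le j\le N$, and $\psi(P_NT_\sigma P_N)$ is defined by the functional calculus. Write $\inf\sigma$ and $\sup\sigma$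 for the essential infimum and supremum of $\sigma$. A real-valued $\sigma\in L^\infty(\mathbb{C},\nu)$ has the radial limit $\tilde\sigma$ if $\sigma(re^{i\theta})\to\tilde\sigma(\theta)$ as $r\to\infty$ for almost every $\theta\in[0,2\pi)$. 1. (Moments.) Let $c_n=\int_0^\infty r^n\,2e^{-r^2}\,dr$. Then $c_{2n+1}=n!$ for all $n\ge 0$; $c_{n+1}/c_n\to\infty$ as $n\to\infty$ (that is, $R=\infty$); and for every integer $m\ge 0$, $$\lim_{l\to\infty}\frac{c_{2l+m+1}}{\sqrt{c_{2l+2m+1}}\,\sqrt{c_{2l+1}}}=1 .$$ Suppose now that $\sigma\in L^\infty(\mathbb{C},\nu)$ is real-valued and has a radial limit $\tilde\sigma$. 2. (Szegő limit.) For every $N$ the spectrum of $P_NT_\sigma P_N$ is contained in $[\inf\sigma,\sup\sigma]$. For every continuous $\psi:[\inf\sigma,\sup\sigma]\to\mathbb{C}$ the function $\psi\circ\tilde\sigma$ is integrable on $[0,2\pi]$ and $$\lim_{N\to\infty}\frac{1}{N+1}\,\mathrm{tr}\bigl(\psi(P_NT_\sigma P_N)\bigr)=\frac1{2\pi}\int_0^{2\pi}\psi(\tilde\sigma(\theta))\,d\theta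 .$$ 3. (Eigenvalue density.) For all $\alpha,\beta\in(\inf\sigma,\sup\sigma)$ with $\alpha<\beta$, with either $\alpha>0$ or $\beta<0$, and with $|\{\theta\in[0,2\pi):\tilde\sigma(\theta)=\alpha\}|=|\{\theta\in[0,2\pi):\tilde\sigma(\theta)=\beta\}|=0$, $$\lim_{N\to\infty}\frac{\#\{0\le j\le N:\alpha<\lambda_j^N(\sigma)<\beta\}}{N+1}=\frac{|\{\theta\in[0,2\pi):\alpha<\tilde\sigma(\theta)<\beta\}|}{2\pi}.$$ -/

import Mathlib

open MeasureTheory Filter Topology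
open scoped ENNReal Nat

noncomputable section

namespace Fock

/-! ### The Gaussian measure and the Segal–Bargmann–Fock space -/

/-- The density `π⁻¹ exp (-|z|²)`. -/
def density (z : ℂ) : ℝ := Real.pi⁻¹ * Real.exp (-‖z‖ ^ 2)

/-- The Gaussian measure `exp (-|z|²) dz / π` on `ℂ`. -/
def gaussian : Measure ℂ := volume.withDensity fun z => ENNReal.ofReal (density z)

lemma density_pos (z : ℂ) : 0 < density z := by
  unfold density; positivity

lemma continuous_density : Continuous density := by
  unfold density; fun_prop

lemma integrable_exp_neg_mul_sq {b : ℝ} (hb : 0 < b) :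
    Integrable fun z : ℂ => Real.exp (-b * ‖z‖ ^ 2) := by
  by_contra h
  have h1 := GaussianFourier.integral_rexp_neg_mul_sq_norm (V := ℂ) hb
  rw [integral_undef h] at h1
  have : 0 < (Real.pi / b) ^ ((Module.finrank ℝ ℂ : ℝ) / 2) := by positivity
  linarith

instance : IsProbabilityMeasure gaussian := by
  constructor
  have h1 : Integrable fun z : ℂ => density z := by
    have := (integrable_exp_neg_mul_sq one_pos).const_mul Real.pi⁻¹
    simpa [density] using this
  have h2 : ∫ z : ℂ, density z = 1 := by
    have := GaussianFourier.integral_rexp_neg_mul_sq_norm (V := ℂ) one_pos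
    simp only [neg_mul, one_mul] at this
    simp only [density, integral_const_mul, this, Complex.finrank_real_complex]
    norm_num
  rw [gaussian, withDensity_apply _ MeasurableSet.univ, Measure.restrict_univ,
    ← ofReal_integral_eq_lintegral_ofReal h1 (.of_forall fun z => (density_pos z).le), h2,
    ENNReal.ofReal_one]

lemma volume_ac_gaussian : (volume : Measure ℂ) ≪ gaussian :=
  withDensity_absolutelyContinuous' (by
    have := continuous_density
    fun_prop) (.of_forall fun z => by simpa using density_pos z)

instance : gaussian.IsOpenPosMeasure := volume_ac_gaussian.isOpenPosMeasure

/-- The Segal–Bargmann–Fock space `F²(ℂ)`: the entire functions which are square integrable with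
respect to the Gaussian measure, as a subspace of `L²`. -/
def space : Submodule ℂ (Lp ℂ 2 gaussian) where
  carrier := {f | ∃ F : ℂ → ℂ, Differentiable ℂ F ∧ f =ᵐ[gaussian] F}
  zero_mem' := ⟨0, differentiable_const 0, Lp.coeFn_zero _ _ _⟩
  add_mem' := by
    rintro f g ⟨F, hF, hf⟩ ⟨G, hG, hg⟩
    exact ⟨F + G, hF.add hG, (Lp.coeFn_add f g).trans (hf.add hg)⟩
  smul_mem' := by
    rintro c f ⟨F, hF, hf⟩
    refine ⟨fun z => c • F z, hF.const_smul c, (Lp.coeFn_smul c f).trans ?_⟩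
    filter_upwards [hf] with z hz
    simp [hz]

/-! ### The Fock space is closed in `L²` -/

lemma enorm_le_circle {F : ℂ → ℂ} (hF : Differentiable ℂ F) (z : ℂ) (r : ℝ) :
    ENNReal.ofReal (2 * Real.pi) * ‖F z‖ₑ
      ≤ ∫⁻ θ in Set.Ioo (-Real.pi) Real.pi, ‖F (z + r * Complex.exp (θ * Complex.I))‖ₑ := by
  have h1 : Real.circleAverage F z r = F z :=
    DiffContOnCl.circleAverage hF.diffContOnCl
  rw [Real.circleAverage] at h1
  have hper : Function.Periodic (fun θ : ℝ => F (circleMap z r θ)) (2 * Real.pi) :=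
    (periodic_circleMap z r).comp F
  have h2 := hper.intervalIntegral_add_eq 0 (-Real.pi)
  rw [zero_add] at h2
  rw [h2, show -Real.pi + 2 * Real.pi = Real.pi by ring,
    intervalIntegral.integral_of_le (by linarith [Real.pi_pos]),
    integral_Ioc_eq_integral_Ioo] at h1
  have h3 : (2 * Real.pi) • F z
      = ∫ θ in Set.Ioo (-Real.pi) Real.pi, F (circleMap z r θ) := by
    rw [← h1, smul_smul, mul_inv_cancel₀ (by positivity), one_smul]
  have h4 := enorm_integral_le_lintegral_enorm
    (μ := volume.restrict (Set.Ioo (-Real.pi) Real.pi)) (fun θ : ℝ => F (circleMap z r θ))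
  rw [← h3, enorm_smul, Real.enorm_of_nonneg (by positivity)] at h4
  simpa only [circleMap] using h4

/-- The sub-mean-value property over a disc of radius one. -/
lemma enorm_le_ball {F : ℂ → ℂ} (hF : Differentiable ℂ F) (z : ℂ) :
    ENNReal.ofReal Real.pi * ‖F z‖ₑ ≤ ∫⁻ w in Metric.ball z 1, ‖F w‖ₑ := by
  have hc := hF.continuous
  have e1 : ∫⁻ w in Metric.ball z 1, ‖F w‖ₑ
      = ∫⁻ w, (Metric.ball (0 : ℂ) 1).indicator (fun w => ‖F (z + w)‖ₑ) w := by
    rw [← lintegral_indicator Metric.isOpen_ball.measurableSet,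
      ← lintegral_add_left_eq_self _ z]
    refine lintegral_congr fun w => ?_
    by_cases h : ‖w‖ < 1 <;> simp [Set.indicator, h]
  have e2 : ∫⁻ w, (Metric.ball (0 : ℂ) 1).indicator (fun w => ‖F (z + w)‖ₑ) w
      = ∫⁻ r in Set.Ioi (0 : ℝ), ∫⁻ θ in Set.Ioo (-Real.pi) Real.pi,
          ENNReal.ofReal r • (Metric.ball (0 : ℂ) 1).indicator (fun w => ‖F (z + w)‖ₑ)
            (r * Complex.exp (θ * Complex.I)) := by
    rw [← Complex.lintegral_comp_polarCoord_symm, polarCoord_target, Measure.volume_eq_prod,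
      setLIntegral_prod]
    · refine lintegral_congr fun r => lintegral_congr fun θ => ?_
      rw [Complex.polarCoord_symm_apply, Complex.exp_mul_I]
      simp
    · refine Measurable.aemeasurable ?_
      simp only [Complex.polarCoord_symm_apply, smul_eq_mul]
      refine Measurable.mul (by fun_prop) ?_
      refine Measurable.comp (g := (Metric.ball (0 : ℂ) 1).indicator (fun w => ‖F (z + w)‖ₑ))
        ?_ (by fun_prop)
      exact Measurable.indicator (hc.comp (by fun_prop)).enorm.measurable Metric.isOpen_ball.measurableSet
  rw [e1, e2]
  calc ENNReal.ofReal Real.pi * ‖F z‖ₑ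
      = ∫⁻ r in Set.Ioo (0 : ℝ) 1,
          ENNReal.ofReal r * (ENNReal.ofReal (2 * Real.pi) * ‖F z‖ₑ) := by
        have hI : ∫⁻ r in Set.Ioo (0 : ℝ) 1, ENNReal.ofReal r = ENNReal.ofReal (1 / 2) := by
          rw [← ofReal_integral_eq_lintegral_ofReal]
          · rw [← integral_Ioc_eq_integral_Ioo,
              ← intervalIntegral.integral_of_le zero_le_one, integral_id]
            norm_num
          · exact (continuous_id.integrableOn_Icc).mono_set Set.Ioo_subset_Icc_self
          · exact (ae_restrict_iff' measurableSet_Ioo).2 (.of_forall fun r hr => hr.1.le)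
        rw [lintegral_mul_const _ (by fun_prop), hI, ← mul_assoc,
          ← ENNReal.ofReal_mul (by norm_num)]
        congr 2
        ring
    _ ≤ ∫⁻ r in Set.Ioo (0 : ℝ) 1, ∫⁻ θ in Set.Ioo (-Real.pi) Real.pi,
          ENNReal.ofReal r • (Metric.ball (0 : ℂ) 1).indicator (fun w => ‖F (z + w)‖ₑ)
            (r * Complex.exp (θ * Complex.I)) := by
        refine setLIntegral_mono' measurableSet_Ioo fun r hr => ?_
        simp only [smul_eq_mul]
        rw [lintegral_const_mul' _ _ ENNReal.ofReal_ne_top]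
        gcongr
        refine (enorm_le_circle hF z r).trans_eq ?_
        refine lintegral_congr fun θ => ?_
        rw [Set.indicator_of_mem]
        simp [Complex.norm_exp_ofReal_mul_I, abs_of_pos hr.1, hr.2]
    _ ≤ _ := lintegral_mono_set Set.Ioo_subset_Ioi_self

lemma enorm_le_eLpNorm {F : ℂ → ℂ} (hF : Differentiable ℂ F) (R : ℝ) {z : ℂ} (hz : ‖z‖ ≤ R) :
    ‖F z‖ₑ ≤ ENNReal.ofReal (Real.exp ((R + 1) ^ 2)) * eLpNorm F 2 gaussian := by
  have hc := hF.continuous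
  have hd := continuous_density
  have h1 : ∫⁻ w in Metric.ball z 1, ‖F w‖ₑ
      ≤ ENNReal.ofReal (Real.pi * Real.exp ((R + 1) ^ 2)) * eLpNorm F 1 gaussian := by
    rw [eLpNorm_one_eq_lintegral_enorm, gaussian,
      lintegral_withDensity_eq_lintegral_mul _ (by fun_prop) (by fun_prop),
      ← lintegral_const_mul' _ _ ENNReal.ofReal_ne_top]
    refine le_trans ?_ (setLIntegral_le_lintegral (Metric.ball z 1) _)
    refine setLIntegral_mono' Metric.isOpen_ball.measurableSet fun w hw => ?_
    simp only [Pi.mul_apply]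
    rw [← mul_assoc, ← ENNReal.ofReal_mul (by positivity)]
    refine le_mul_of_one_le_left' ?_
    rw [ENNReal.one_le_ofReal, density]
    have hw1 : ‖w‖ ≤ R + 1 := by
      have := norm_le_norm_add_norm_sub' w z
      rw [Metric.mem_ball, dist_eq_norm] at hw
      linarith
    have : Real.pi * Real.exp ((R + 1) ^ 2) * (Real.pi⁻¹ * Real.exp (-‖w‖ ^ 2))
        = Real.exp ((R + 1) ^ 2 - ‖w‖ ^ 2) := by
      rw [sub_eq_add_neg, Real.exp_add]
      field_simp
    rw [this]
    refine Real.one_le_exp ?_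
    have := norm_nonneg w
    nlinarith
  have h2 : eLpNorm F 1 gaussian ≤ eLpNorm F 2 gaussian :=
    eLpNorm_le_eLpNorm_of_exponent_le (by norm_num) hc.aestronglyMeasurable
  have h3 := (enorm_le_ball hF z).trans (h1.trans (mul_le_mul_right h2 _))
  rw [ENNReal.ofReal_mul Real.pi_pos.le, mul_assoc] at h3
  exact (ENNReal.mul_le_mul_iff_right (by simpa using Real.pi_pos) ENNReal.ofReal_ne_top).1 h3

lemma isClosed_space : IsClosed (space : Set (Lp ℂ 2 gaussian)) := by
  rw [← isSeqClosed_iff_isClosed]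
  intro f g hf hfg
  choose F hF hfF using hf
  have bound : ∀ (R : ℝ) (m n : ℕ) (z : ℂ), ‖z‖ ≤ R →
      ‖F m z - F n z‖ ≤ Real.exp ((R + 1) ^ 2) * ‖f m - f n‖ := by
    intro R m n z hz
    have h1 := enorm_le_eLpNorm ((hF m).sub (hF n)) R hz
    have h2 : eLpNorm (F m - F n) 2 gaussian = ‖f m - f n‖ₑ := by
      rw [Lp.enorm_def]
      refine eLpNorm_congr_ae ?_
      filter_upwards [Lp.coeFn_sub (f m) (f n), hfF m, hfF n] with w h1 h2 h3
      rw [h1, Pi.sub_apply, Pi.sub_apply, h2, h3]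
    rw [h2, ← ofReal_norm, ← ofReal_norm, ← ENNReal.ofReal_mul (Real.exp_pos _).le] at h1
    exact (ENNReal.ofReal_le_ofReal_iff (by positivity)).1 h1
  have cauchy : ∀ R : ℝ, UniformCauchySeqOn F atTop (Metric.closedBall 0 R) := by
    intro R
    rw [Metric.uniformCauchySeqOn_iff]
    intro ε hε
    obtain ⟨N, hN⟩ := Metric.cauchySeq_iff.1 hfg.cauchySeq
      (ε / Real.exp ((R + 1) ^ 2)) (by positivity)
    refine ⟨N, fun m hm n hn z hz => ?_⟩
    rw [dist_eq_norm]
    refine (bound R m n z (by simpa using hz)).trans_lt ?_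
    have := hN m hm n hn
    rw [dist_eq_norm, lt_div_iff₀ (by positivity)] at this
    linarith
  have lim : ∀ z, ∃ w, Tendsto (fun n => F n z) atTop (𝓝 w) := fun z =>
    cauchySeq_tendsto_of_complete ((cauchy ‖z‖).cauchySeq (by simp))
  choose G hG using lim
  have hloc : TendstoLocallyUniformly F G atTop := by
    rw [tendstoLocallyUniformly_iff_forall_isCompact]
    intro K hK
    obtain ⟨R, hR⟩ := hK.isBounded.subset_closedBall 0
    exact ((cauchy R).tendstoUniformlyOn_of_tendsto fun z _ => hG z).mono hR
  refine ⟨G, ?_, ?_⟩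
  · rw [← differentiableOn_univ]
    exact (tendstoLocallyUniformlyOn_univ.2 hloc).differentiableOn
      (.of_forall fun n => (hF n).differentiableOn) isOpen_univ
  · obtain ⟨ns, hns, h⟩ := (tendstoInMeasure_of_tendsto_Lp hfg).exists_seq_tendsto_ae
    have hall : ∀ᵐ z ∂gaussian, ∀ n, f n z = F n z := ae_all_iff.2 hfF
    filter_upwards [h, hall] with z hz hz2
    simp only [hz2] at hz
    exact tendsto_nhds_unique hz ((hG z).comp hns.tendsto_atTop)

instance : CompleteSpace space := isClosed_space.completeSpace_coe

/-! ### Monomials and the subspaces `K_N` -/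

lemma memLp_pow (n : ℕ) : MemLp (fun z : ℂ => z ^ n) 2 gaussian := by
  have hd := continuous_density
  rw [memLp_two_iff_integrable_sq_norm (by fun_prop), gaussian,
    integrable_withDensity_iff_integrable_smul' (by fun_prop) (by simp)]
  refine ((integrable_exp_neg_mul_sq (b := 1 / 2) (by norm_num)).const_mul
    (2 ^ n * n ! : ℝ)).mono' (by
      refine Continuous.aestronglyMeasurable ?_
      simp only [ENNReal.toReal_ofReal (density_pos _).le]
      fun_prop) (.of_forall fun z => ?_)
  rw [ENNReal.toReal_ofReal (density_pos z).le, smul_eq_mul, Real.norm_of_nonneg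
    (mul_nonneg (density_pos z).le (by positivity)), norm_pow, density]
  have h1 := Real.pow_div_factorial_le_exp (‖z‖ ^ 2 / 2) (by positivity) n
  rw [div_le_iff₀ (by positivity), div_pow, div_le_iff₀ (by positivity)] at h1
  have h2 : Real.pi⁻¹ ≤ 1 := inv_le_one_of_one_le₀ (by linarith [Real.pi_gt_three])
  have h3 : Real.exp (-‖z‖ ^ 2) = Real.exp (-(1 / 2) * ‖z‖ ^ 2) * Real.exp (-(‖z‖ ^ 2 / 2)) := by
    rw [← Real.exp_add]; ring_nf
  have h4 : Real.exp (‖z‖ ^ 2 / 2) * Real.exp (-(‖z‖ ^ 2 / 2)) = 1 := by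
    rw [← Real.exp_add]; simp
  calc Real.pi⁻¹ * Real.exp (-‖z‖ ^ 2) * (‖z‖ ^ n) ^ 2
      ≤ 1 * Real.exp (-‖z‖ ^ 2) * (Real.exp (‖z‖ ^ 2 / 2) * n ! * 2 ^ n) := by
        rw [← pow_mul, mul_comm n 2, pow_mul]; gcongr
    _ = 2 ^ n * n ! * Real.exp (-(1 / 2) * ‖z‖ ^ 2)
          * (Real.exp (‖z‖ ^ 2 / 2) * Real.exp (-(‖z‖ ^ 2 / 2))) := by rw [h3]; ring
    _ = _ := by rw [h4, mul_one]

lemma memLp_monomial (n : ℕ) :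
    MemLp (fun z : ℂ => z ^ n / (Real.sqrt (n ! : ℝ) : ℂ)) 2 gaussian := by
  simpa only [div_eq_inv_mul] using (memLp_pow n).const_mul ((Real.sqrt (n ! : ℝ) : ℂ)⁻¹)

/-- The normalized monomial `zⁿ / √(n!)` as an element of the Fock space. -/
def monomial (n : ℕ) : space :=
  ⟨(memLp_monomial n).toLp, _, by fun_prop, (memLp_monomial n).coeFn_toLp⟩

lemma linearIndependent_monomial (N : ℕ) :
    LinearIndependent ℂ fun k : Fin (N + 1) => monomial k := by
  rw [Fintype.linearIndependent_iff]
  intro c hc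
  have h0 : ∀ k : ℕ, (Real.sqrt (k ! : ℝ) : ℂ) ≠ 0 := fun k => by
    have : 0 < Real.sqrt (k ! : ℝ) := Real.sqrt_pos.2 (by positivity)
    exact_mod_cast this.ne'
  let p : Polynomial ℂ := ∑ k : Fin (N + 1),
    Polynomial.monomial k (c k / (Real.sqrt ((k : ℕ) ! : ℝ) : ℂ))
  have h1 : (fun z => p.eval z) =ᵐ[gaussian] fun _ => 0 := by
    have h2 : ((∑ k : Fin (N + 1), c k • (monomial k : Lp ℂ 2 gaussian) : Lp ℂ 2 gaussian))
        = 0 := by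
      have := congrArg (Subtype.val) hc
      simpa using this
    have h3 := Lp.coeFn_zero ℂ 2 gaussian
    rw [← h2] at h3
    have h4 : ∀ᵐ z ∂gaussian, ∀ k : Fin (N + 1),
        (c k • (monomial k : Lp ℂ 2 gaussian) : Lp ℂ 2 gaussian) z
          = c k * (z ^ (k : ℕ) / (Real.sqrt ((k : ℕ) ! : ℝ) : ℂ)) := by
      refine ae_all_iff.2 fun k => ?_
      filter_upwards [Lp.coeFn_smul (c k) (monomial k : Lp ℂ 2 gaussian),
        (memLp_monomial k).coeFn_toLp] with z h5 h6
      rw [h5, Pi.smul_apply, smul_eq_mul]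
      exact congrArg _ h6
    have h7 := Lp.coeFn_finsetSum Finset.univ
      (fun k : Fin (N + 1) => (c k • (monomial k : Lp ℂ 2 gaussian) : Lp ℂ 2 gaussian))
    filter_upwards [h3, h4, h7] with z h3 h4 h7
    rw [h7, Finset.sum_apply] at h3
    simp only [h4] at h3
    simp only [p, Polynomial.eval_finsetSum, Polynomial.eval_monomial]
    rw [Pi.zero_apply] at h3
    rw [← h3]
    exact Finset.sum_congr rfl fun k _ => by ring
  rw [Continuous.ae_eq_iff_eq gaussian p.continuous continuous_const] at h1
  have hp : p = 0 := Polynomial.funext fun z => by simpa using congrFun h1 z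
  intro k
  have h8 := congrArg (fun q => Polynomial.coeff q (k : ℕ)) hp
  simp only [p, Polynomial.finsetSum_coeff, Polynomial.coeff_monomial, Polynomial.coeff_zero,
    Fin.val_inj, Finset.sum_ite_eq', Finset.mem_univ, if_true] at h8
  exact (div_eq_zero_iff.1 h8).resolve_right (h0 k)

/-- `K_N = span {zⁿ / √(n!) : n = 0, …, N}`. -/
def K (N : ℕ) : Submodule ℂ space := Submodule.span ℂ (Set.range fun k : Fin (N + 1) => monomial k)

instance (N : ℕ) : FiniteDimensional ℂ (K N) := FiniteDimensional.span_of_finite ℂ (Set.finite_range _)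

instance (N : ℕ) : CompleteSpace (K N) := FiniteDimensional.complete ℂ _

lemma finrank_K (N : ℕ) : Module.finrank ℂ (K N) = N + 1 := by
  rw [K, finrank_span_eq_card (linearIndependent_monomial N), Fintype.card_fin]

/-! ### Toeplitz operators and their radial compressions -/

/-- The multiplication operator `M_s` on `L²` with symbol `s ∈ L^∞`. -/
def mulOp (s : Lp ℂ ∞ gaussian) : Lp ℂ 2 gaussian →L[ℂ] Lp ℂ 2 gaussian :=
  (ContinuousLinearMap.mul ℂ ℂ).holderL gaussian ∞ 2 2 s

lemma coeFn_mulOp (s : Lp ℂ ∞ gaussian) (f : Lp ℂ 2 gaussian) :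
    mulOp s f =ᵐ[gaussian] fun z => s z * f z :=
  (ContinuousLinearMap.mul ℂ ℂ).coeFn_holder s f

/-- The Toeplitz operator `T_s = P M_s` on the Fock space, where `P` is the orthogonal projection of
`L²` onto the Fock space. -/
def toeplitz (s : Lp ℂ ∞ gaussian) : space →L[ℂ] space :=
  space.orthogonalProjectionOnto ∘L mulOp s ∘L space.subtypeL

/-- The compression `P_N T_s P_N`, as an operator on the `(N + 1)`-dimensional space `K_N`, where
`P_N` is the orthogonal projection of the Fock space onto `K_N`. -/
def compression (s : Lp ℂ ∞ gaussian) (N : ℕ) : K N →L[ℂ] K N :=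
  (K N).orthogonalProjectionOnto ∘L toeplitz s ∘L (K N).subtypeL

/-- A bounded real-valued function as a complex symbol. -/
def realSymbol (σ : ℂ → ℝ) (hσ : MemLp σ ∞ gaussian) : Lp ℂ ∞ gaussian :=
  (hσ.ofReal (K := ℂ)).toLp

lemma compression_isSymmetric (σ : ℂ → ℝ) (hσ : MemLp σ ∞ gaussian) (N : ℕ) :
    LinearMap.IsSymmetric (𝕜 := ℂ) (E := K N) (compression (realSymbol σ hσ) N).toLinearMap := by
  have hM : ∀ f g : Lp ℂ 2 gaussian,
      inner ℂ (mulOp (realSymbol σ hσ) f) g = inner ℂ f (mulOp (realSymbol σ hσ) g) := by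
    intro f g
    rw [L2.inner_def, L2.inner_def]
    refine integral_congr_ae ?_
    filter_upwards [coeFn_mulOp (realSymbol σ hσ) f, coeFn_mulOp (realSymbol σ hσ) g,
      (hσ.ofReal (K := ℂ)).coeFn_toLp] with z h1 h2 h3
    have h3' : realSymbol σ hσ z = (σ z : ℂ) := h3
    rw [h1, h2, h3']
    simp [mul_assoc, mul_left_comm]
  intro f g
  simp only [compression, toeplitz, ContinuousLinearMap.coe_coe, ContinuousLinearMap.comp_apply,
    Submodule.subtypeL_apply, Submodule.inner_orthogonalProjectionOnto_eq_of_mem_right,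
    Submodule.inner_orthogonalProjectionOnto_eq_of_mem_left]
  exact hM _ _

/-- The eigenvalues `λ_j^N(σ)`, `0 ≤ j ≤ N`, of `P_N T_σ P_N`, repeated according to multiplicity,
for a real symbol `σ`. -/
def eigenvalue (σ : ℂ → ℝ) (hσ : MemLp σ ∞ gaussian) (N : ℕ) : Fin (N + 1) → ℝ :=
  LinearMap.IsSymmetric.eigenvalues (𝕜 := ℂ) (E := K N) (compression_isSymmetric σ hσ N) (finrank_K N)

/-- `ψ(A)` for a self-adjoint operator `A` and a complex-valued function `ψ` of a real variable,
by the continuous functional calculus. -/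
def applyFun {H : Type*} [NormedAddCommGroup H] [InnerProductSpace ℂ H] [CompleteSpace H]
    (ψ : ℝ → ℂ) (A : H →L[ℂ] H) : H →L[ℂ] H :=
  cfc (fun z : ℂ => ψ z.re) A

/-- The trace of `ψ(P_N T_σ P_N)`. -/
def traceFun (σ : ℂ → ℝ) (hσ : MemLp σ ∞ gaussian) (ψ : ℝ → ℂ) (N : ℕ) : ℂ :=
  LinearMap.trace ℂ (K N) (applyFun (H := K N) ψ (compression (realSymbol σ hσ) N)).toLinearMap

/-- `σ` has the radial limit `σt`: `σ (r e^{iθ}) → σt θ` as `r → ∞`, for almost every angle. -/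
def HasRadialLimit (σ : ℂ → ℝ) (σt : ℝ → ℝ) : Prop :=
  ∀ᵐ θ : ℝ ∂(volume.restrict (Set.Ico 0 (2 * Real.pi))),
    Tendsto (fun r : ℝ => σ (r * Complex.exp (θ * Complex.I))) atTop (𝓝 (σt θ))

/-- The moments `c_n = ∫₀^∞ rⁿ dμ(r)` of the radial measure `dμ(r) = 2 exp (-r²) dr`. -/
def moment (n : ℕ) : ℝ := ∫ r in Set.Ioi (0 : ℝ), r ^ n * (2 * Real.exp (-r ^ 2))

end Fock

end

/-!
Why the theorem is true. In the orthonormal basis of normalized monomials the matrix of the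
Toeplitz operator with a bounded symbol having a radial limit is asymptotically a classical
Toeplitz matrix, and the classical argument for Szegő's theorem applies to it.

Under the Gaussian measure the argument and the modulus are independent
(`measurePreserving_polarMap`), and the weight `r^p` against the law of the modulus, normalized by
the moment `c_{p+1}`, moves to infinity because the moments grow superexponentially
(`tendsto_integral_radial`). Hence weighted averages of a bounded function over the plane converge
to the mean of its radial limit (`HasAngularLimit.tendsto_integral`). Together with the moment
condition `tendsto_moment_sq_div`, a consequence of the log-convexity of the Gamma function, this
gives the limits of the matrix coefficients of multiplication by `σ^j` along each diagonal: they
are the Fourier coefficients of `σt^j` (`tendsto_inner_monomial`).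

By Parseval's identity on the circle finitely many diagonals exhaust the norm of `σ^j zᵐ / √(m!)`,
so that for `m` far from both ends of `{0, …, N}` this vector is nearly contained in `K_N`
(`tendsto_norm_sub_projK`). So the `j`-th power of the compression acts on most basis vectors like
multiplication by `σ^j`, and the mean of the `j`-th powers of the eigenvalues, which is a
normalized trace, tends to the mean of `σt^j` (`tendsto_average_eigenvalue_pow`). Weierstrass
approximation on `[inf σ, sup σ]` extends this to continuous functions. In other words the
eigenvalue counting measures converge weakly to the distribution of `σt`, and the portmanteau
theorem gives the density of eigenvalues in intervals whose end points are not charged.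

A symbol is only determined up to null sets, while radial limits are pointwise. Fubini's theorem
shows that replacing the symbol by a measurable representative changes it on almost every ray only
on a null set of radii, so limits along rays are taken off null sets of radii, that is, along the
filter `atTop ⊓ ae radial`.
-/

noncomputable section

namespace Fock

/-! ### Moments -/

lemma moment_eq_Gamma (n : ℕ) : moment n = Real.Gamma ((n + 1 : ℝ) / 2) := by
  have h := integral_rpow_mul_exp_neg_rpow (p := 2) (q := n) two_pos
    (by have : (0 : ℝ) ≤ n := n.cast_nonneg
        linarith)
  have h2 : moment n = 2 * ∫ x in Set.Ioi (0 : ℝ), x ^ (n : ℝ) * Real.exp (-x ^ (2 : ℝ)) := by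
    rw [moment, ← integral_const_mul]
    refine integral_congr_ae (.of_forall fun x => ?_)
    simp only [Real.rpow_natCast, Real.rpow_two]
    ring
  rw [h2, h]
  ring

lemma moment_pos (n : ℕ) : 0 < moment n := by
  rw [moment_eq_Gamma]
  exact Real.Gamma_pos_of_pos (by positivity)

lemma moment_two_mul_add_one (n : ℕ) : moment (2 * n + 1) = (n ! : ℝ) := by
  rw [moment_eq_Gamma, ← Real.Gamma_nat_eq_factorial]
  congr 1
  push_cast
  ring

lemma moment_add_two (n : ℕ) : moment (n + 2) = (n + 1 : ℝ) / 2 * moment n := by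
  rw [moment_eq_Gamma, moment_eq_Gamma, ← Real.Gamma_add_one (by positivity)]
  congr 1
  push_cast
  ring

/-- The ratio `c_{n+1} / c_n` of consecutive moments. -/
def momentRatio (n : ℕ) : ℝ := moment (n + 1) / moment n

lemma momentRatio_pos (n : ℕ) : 0 < momentRatio n := div_pos (moment_pos _) (moment_pos _)

lemma momentRatio_mul_succ (n : ℕ) : momentRatio n * momentRatio (n + 1) = (n + 1 : ℝ) / 2 := by
  have h0 := (moment_pos n).ne'
  have h1 := (moment_pos (n + 1)).ne'
  rw [momentRatio, momentRatio, show n + 1 + 1 = n + 2 from rfl, moment_add_two]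
  field_simp

/-- Log-convexity of the moments, from that of the Gamma function. -/
lemma momentRatio_monotone : Monotone momentRatio := by
  refine monotone_nat_of_le_succ fun n => ?_
  have h := Real.Gamma_mul_add_mul_le_rpow_Gamma_mul_rpow_Gamma (s := (n + 1 : ℝ) / 2)
    (t := (n + 3 : ℝ) / 2) (a := 1 / 2) (b := 1 / 2) (by positivity) (by positivity)
    (by norm_num) (by norm_num) (by norm_num)
  have e1 : moment (n + 1)
      = Real.Gamma (1 / 2 * ((n + 1 : ℝ) / 2) + 1 / 2 * ((n + 3 : ℝ) / 2)) := by
    rw [moment_eq_Gamma]; congr 1; push_cast; ring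
  have e2 : moment (n + 2) = Real.Gamma ((n + 3 : ℝ) / 2) := by
    rw [moment_eq_Gamma]; congr 1; push_cast; ring
  rw [← e1, ← e2, ← moment_eq_Gamma, ← Real.sqrt_eq_rpow, ← Real.sqrt_eq_rpow,
    ← Real.sqrt_mul (moment_pos n).le] at h
  have h2 := (Real.le_sqrt (moment_pos _).le
    (mul_pos (moment_pos n) (moment_pos (n + 2))).le).1 h
  rw [momentRatio, momentRatio, div_le_div_iff₀ (moment_pos _) (moment_pos _)]
  nlinarith

lemma tendsto_momentRatio_atTop : Tendsto momentRatio atTop atTop := by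
  rw [← tendsto_add_atTop_iff_nat 1]
  have h1 : Tendsto (fun n : ℕ => √((n : ℝ) / 2)) atTop atTop :=
    Real.tendsto_sqrt_atTop.comp (tendsto_natCast_atTop_atTop.atTop_div_const two_pos)
  refine tendsto_atTop_mono (fun n => ?_) h1
  refine Real.sqrt_le_iff.2 ⟨(momentRatio_pos _).le, ?_⟩
  have h2 := momentRatio_mul_succ n
  have h3 := momentRatio_monotone n.le_succ
  have h4 := momentRatio_pos (n + 1)
  simp only [Nat.succ_eq_add_one] at h3
  nlinarith

lemma tendsto_momentRatio_succ_div :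
    Tendsto (fun n => momentRatio (n + 1) / momentRatio n) atTop (𝓝 1) := by
  have h1 : Tendsto (fun n : ℕ => 1 + 1 / ((n : ℝ) + 1)) atTop (𝓝 1) := by
    simpa using tendsto_one_div_add_atTop_nhds_zero_nat.const_add (1 : ℝ)
  refine tendsto_of_tendsto_of_tendsto_of_le_of_le tendsto_const_nhds h1 (fun n => ?_) fun n => ?_
  · rw [one_le_div (momentRatio_pos _)]
    exact momentRatio_monotone n.le_succ
  · -- the exact value of `ρ_{n+2} / ρ_n` bounds `ρ_{n+1} / ρ_n`
    have h2 := momentRatio_mul_succ n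
    have h3 := momentRatio_mul_succ (n + 1)
    have h4 : momentRatio (n + 1) ≤ momentRatio (n + 1 + 1) := momentRatio_monotone (Nat.le_succ _)
    have h5 := momentRatio_pos (n + 1)
    have h6 := momentRatio_pos n
    have h7 : (0 : ℝ) < n + 1 := by positivity
    rw [div_le_iff₀ h6]
    push_cast at h3
    have h8 : momentRatio (n + 1) * momentRatio (n + 1) ≤ (n + 1 + 1 : ℝ) / 2 := by nlinarith
    have h9 : (1 + 1 / ((n : ℝ) + 1)) * momentRatio n * momentRatio (n + 1)
        = (n + 1 + 1 : ℝ) / 2 := by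
      rw [mul_assoc, h2]; field_simp
    exact le_of_mul_le_mul_right (by linarith) h5

lemma tendsto_momentRatio_add_div (m : ℕ) :
    Tendsto (fun n => momentRatio (n + m) / momentRatio n) atTop (𝓝 1) := by
  induction m with
  | zero =>
    refine tendsto_const_nhds.congr fun n => ?_
    rw [add_zero, div_self (momentRatio_pos n).ne']
  | succ m ih =>
    have h := (tendsto_momentRatio_succ_div.comp (tendsto_add_atTop_nat m)).mul ih
    rw [mul_one] at h
    refine h.congr fun n => ?_
    simp only [Function.comp_apply]
    rw [← add_assoc, div_mul_div_cancel₀ (momentRatio_pos _).ne']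

lemma moment_add_eq_prod (n m : ℕ) :
    moment (n + m) = moment n * ∏ i ∈ Finset.range m, momentRatio (n + i) := by
  induction m with
  | zero => simp
  | succ m ih =>
    rw [Finset.prod_range_succ, ← mul_assoc, ← ih, momentRatio,
      mul_div_cancel₀ _ (moment_pos _).ne', add_assoc]

/-- The quotient is a product of quotients of moment ratios a bounded distance apart, each of which
tends to one. -/
lemma tendsto_moment_sq_div (m : ℕ) :
    Tendsto (fun n => moment (n + m) / (√(moment (n + 2 * m)) * √(moment n))) atTop (𝓝 1) := by
  have h : Tendsto (fun n => ∏ i ∈ Finset.range m,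
      (momentRatio (n + i + m) / momentRatio (n + i))) atTop (𝓝 (∏ i ∈ Finset.range m, 1)) :=
    tendsto_finsetProd _ fun i _ =>
      (tendsto_momentRatio_add_div m).comp (tendsto_add_atTop_nat i)
  have h2 := (h.inv₀ (by simp)).sqrt
  simp only [Finset.prod_const_one, inv_one, Real.sqrt_one] at h2
  refine h2.congr fun n => ?_
  have e1 := moment_add_eq_prod n m
  have e2 := moment_add_eq_prod (n + m) m
  have p1 := moment_pos n
  have p2 := moment_pos (n + m)
  have p3 := moment_pos (n + 2 * m)
  have e3 : (∏ i ∈ Finset.range m, (momentRatio (n + i + m) / momentRatio (n + i)))⁻¹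
      = moment (n + m) ^ 2 / (moment (n + 2 * m) * moment n) := by
    have e4 : ∀ i, momentRatio (n + i + m) = momentRatio (n + m + i) := fun i => by
      rw [add_right_comm]
    simp only [e4, Finset.prod_div_distrib, inv_div]
    rw [add_assoc, ← two_mul] at e2
    rw [e2]
    have p4 : 0 < ∏ i ∈ Finset.range m, momentRatio (n + m + i) :=
      Finset.prod_pos fun i _ => momentRatio_pos _
    rw [e1] at p2 ⊢
    field_simp
  rw [e3, Real.sqrt_div (by positivity), Real.sqrt_sq p2.le, Real.sqrt_mul p3.le]

/-- The moments grow faster than any geometric sequence. -/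
lemma tendsto_pow_div_moment (R : ℝ) : Tendsto (fun p => R ^ p / moment (p + 1)) atTop (𝓝 0) := by
  rcases eq_or_ne R 0 with rfl | hR
  · refine tendsto_const_nhds.congr' ?_
    filter_upwards [eventually_ne_atTop 0] with p hp
    simp [hp]
  refine (summable_of_ratio_test_tendsto_lt_one zero_lt_one
    (.of_forall fun p => div_ne_zero (pow_ne_zero _ hR) (moment_pos _).ne') ?_).tendsto_atTop_zero
  have h : Tendsto (fun p => |R| * (momentRatio (p + 1))⁻¹) atTop (𝓝 (|R| * 0)) :=
    ((tendsto_inv_atTop_zero.comp tendsto_momentRatio_atTop).comp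
      (tendsto_add_atTop_nat 1)).const_mul _
  rw [mul_zero] at h
  refine h.congr fun p => ?_
  have h1 := (moment_pos (p + 1)).ne'
  have h2 := (moment_pos (p + 1 + 1)).ne'
  have h3 : |R| ≠ 0 := abs_ne_zero.2 hR
  rw [norm_div, norm_div, norm_pow, norm_pow, Real.norm_eq_abs,
    Real.norm_of_nonneg (moment_pos _).le, Real.norm_of_nonneg (moment_pos _).le, momentRatio]
  field_simp
  ring

/-! ### Polar coordinates -/

/-- The normalized arc length `dθ / 2π` on `(0, 2π]`. -/
def angular : Measure ℝ :=
  ENNReal.ofReal (2 * Real.pi)⁻¹ • volume.restrict (Set.Ioc 0 (2 * Real.pi))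

/-- The law `2 r exp (-r²) dr` of the modulus under the Gaussian measure. -/
def radial : Measure ℝ :=
  (volume.restrict (Set.Ioi 0)).withDensity fun r => ENNReal.ofReal (2 * r * Real.exp (-r ^ 2))

/-- The point with polar coordinates `(θ, r)`; the angle comes first. -/
def polarMap (q : ℝ × ℝ) : ℂ := q.2 * Complex.exp (q.1 * Complex.I)

lemma continuous_polarMap : Continuous polarMap := by
  unfold polarMap; fun_prop

instance : IsProbabilityMeasure angular := by
  constructor
  have h := Real.two_pi_pos
  rw [angular, Measure.smul_apply, Measure.restrict_apply_univ, Real.volume_Ioc, smul_eq_mul,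
    ← ENNReal.ofReal_mul (by positivity), sub_zero, inv_mul_cancel₀ h.ne', ENNReal.ofReal_one]

instance : SFinite radial := by unfold radial; infer_instance

lemma integral_angular {E : Type*} [NormedAddCommGroup E] [NormedSpace ℝ E] (f : ℝ → E) :
    ∫ θ, f θ ∂angular = (2 * Real.pi)⁻¹ • ∫ θ in (0 : ℝ)..(2 * Real.pi), f θ := by
  rw [angular, integral_smul_measure, ENNReal.toReal_ofReal (by positivity),
    intervalIntegral.integral_of_le Real.two_pi_pos.le]

lemma ae_angular_iff {p : ℝ → Prop} :
    (∀ᵐ θ ∂angular, p θ) ↔ ∀ᵐ θ ∂volume.restrict (Set.Ioc 0 (2 * Real.pi)), p θ := by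
  rw [angular, Measure.ae_ennreal_smul_measure_iff (by simp [Real.pi_pos])]

lemma ae_radial_pos : ∀ᵐ r ∂radial, 0 < r :=
  (withDensity_absolutelyContinuous _ _) (ae_restrict_mem measurableSet_Ioi)

lemma integral_pow_radial (p : ℕ) : ∫ r, r ^ p ∂radial = moment (p + 1) := by
  rw [radial, integral_withDensity_eq_integral_toReal_smul (by fun_prop) (by simp), moment]
  refine setIntegral_congr_fun measurableSet_Ioi fun r (hr : 0 < r) => ?_
  simp only [smul_eq_mul]
  rw [ENNReal.toReal_ofReal (by positivity)]
  ring

lemma integrable_pow_radial (p : ℕ) : Integrable (fun r : ℝ => r ^ p) radial := by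
  by_contra h
  have h1 := integral_pow_radial p
  rw [integral_undef h] at h1
  exact (moment_pos (p + 1)).ne h1

instance : IsProbabilityMeasure radial := by
  have h1 := integrable_pow_radial 0
  have : IsFiniteMeasure radial := by
    simpa [integrable_const_iff] using h1
  have h2 := integral_pow_radial 0
  have h3 : moment 1 = 1 := by simpa using moment_two_mul_add_one 0
  simp only [pow_zero, integral_const, smul_eq_mul, mul_one, zero_add, h3] at h2
  exact ⟨by rwa [measureReal_def, ENNReal.toReal_eq_one_iff] at h2⟩

lemma neg_polarCoord_symm (q : ℝ × ℝ) :
    -(Complex.polarCoord.symm q) = polarMap (q.2 + Real.pi, q.1) := by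
  rw [Complex.polarCoord_symm_apply, polarMap]
  push_cast
  rw [add_mul, Complex.exp_add, Complex.exp_pi_mul_I, Complex.exp_mul_I]
  ring

/-- Under the Gaussian measure the modulus and the argument are independent, with laws `radial`
and `angular`. -/
lemma measurePreserving_polarMap : MeasurePreserving polarMap (angular.prod radial) gaussian := by
  refine ⟨continuous_polarMap.measurable, Measure.ext_of_lintegral _ fun f hf => ?_⟩
  have hd := continuous_density
  have hp := continuous_polarMap.measurable
  rw [lintegral_map hf hp, lintegral_prod _ (by fun_prop), gaussian,
    lintegral_withDensity_eq_lintegral_mul _ (by fun_prop) hf]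
  set g : ℂ → ℝ≥0∞ := (fun z => ENNReal.ofReal (density z)) * f with hg
  have hgm : Measurable g := by
    rw [hg]; fun_prop
  have hF : Measurable fun q : ℝ × ℝ => ENNReal.ofReal q.1 * g (polarMap (q.2, q.1)) := by fun_prop
  -- Mathlib's polar angle runs over `(-π, π)`; the reflection `z ↦ -z` turns this into `(0, 2π)`
  calc ∫⁻ θ, ∫⁻ r, f (polarMap (θ, r)) ∂radial ∂angular
      = ∫⁻ θ in Set.Ioo 0 (2 * Real.pi), ∫⁻ r in Set.Ioi 0,
          ENNReal.ofReal r * g (polarMap (θ, r)) := by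
        rw [angular, lintegral_smul_measure, restrict_Ioo_eq_restrict_Ioc, smul_eq_mul,
          ← lintegral_const_mul' _ _ ENNReal.ofReal_ne_top]
        refine lintegral_congr fun θ => ?_
        rw [radial, lintegral_withDensity_eq_lintegral_mul _ (by fun_prop) (by fun_prop),
          ← lintegral_const_mul' _ _ ENNReal.ofReal_ne_top]
        refine setLIntegral_congr_fun measurableSet_Ioi fun r (hr : 0 < r) => ?_
        simp only [hg, Pi.mul_apply]
        rw [← mul_assoc, ← mul_assoc, ← ENNReal.ofReal_mul (by positivity),
          ← ENNReal.ofReal_mul hr.le]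
        congr 2
        simp only [density, polarMap, norm_mul, Complex.norm_real, Complex.norm_exp_ofReal_mul_I,
          mul_one, Real.norm_eq_abs, sq_abs]
        have := Real.pi_pos
        field_simp
    _ = ∫⁻ θ in Set.Ioo (-Real.pi) Real.pi, ∫⁻ r in Set.Ioi 0,
          ENNReal.ofReal r * g (polarMap (θ + Real.pi, r)) := by
        rw [← lintegral_indicator measurableSet_Ioo, ← lintegral_indicator measurableSet_Ioo,
          ← lintegral_add_right_eq_self _ Real.pi]
        refine lintegral_congr fun θ => ?_
        have : θ + Real.pi ∈ Set.Ioo 0 (2 * Real.pi) ↔ θ ∈ Set.Ioo (-Real.pi) Real.pi := by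
          simp only [Set.mem_Ioo]
          constructor <;> rintro ⟨h1, h2⟩ <;> constructor <;> linarith
        by_cases h : θ ∈ Set.Ioo (-Real.pi) Real.pi
        · rw [Set.indicator_of_mem h, Set.indicator_of_mem (this.2 h)]
        · rw [Set.indicator_of_notMem h, Set.indicator_of_notMem (mt this.1 h)]
    _ = ∫⁻ z, g (-z) := by
        rw [← Complex.lintegral_comp_polarCoord_symm, polarCoord_target, Measure.volume_eq_prod,
          ← Measure.prod_restrict, lintegral_prod_symm]
        · simp only [neg_polarCoord_symm, smul_eq_mul]
        · simp only [neg_polarCoord_symm, smul_eq_mul]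
          have hm : Measurable fun q : ℝ × ℝ => (q.2 + Real.pi, q.1) := by fun_prop
          exact (measurable_fst.ennreal_ofReal.mul (hgm.comp (hp.comp hm))).aemeasurable
    _ = ∫⁻ z, g z := lintegral_neg_eq_self g

/-! ### Concentration of the radial weights at infinity -/

/-- The probability measures `r^p 2 r exp (-r²) dr / c_{p+1}` move all their mass to infinity, so
that a bounded function is averaged to its limit. Passing to `ae radial` allows a change of the
function on a null set. -/
lemma tendsto_integral_radial {f : ℝ → ℂ} (hf : AEStronglyMeasurable f radial) {C : ℝ}
    (hC : ∀ r, ‖f r‖ ≤ C) {L : ℂ} (hL : Tendsto f (atTop ⊓ ae radial) (𝓝 L)) :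
    Tendsto (fun p : ℕ => (moment (p + 1))⁻¹ • ∫ r, r ^ p • f r ∂radial) atTop (𝓝 L) := by
  have hC0 : 0 ≤ C := (norm_nonneg _).trans (hC 0)
  rw [Metric.tendsto_nhds]
  intro ε hε
  obtain ⟨A, hA, B, hB, hAB⟩ := mem_inf_iff.1 (Metric.tendsto_nhds.1 hL (ε / 2) (by positivity))
  obtain ⟨R, hR⟩ := mem_atTop_sets.1 hA
  have h2 : ∀ p : ℕ, ‖(moment (p + 1))⁻¹ • ∫ r, r ^ p • f r ∂radial - L‖
      ≤ ε / 2 + (C + ‖L‖) * (|R| ^ p / moment (p + 1)) := by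
    intro p
    have hm := moment_pos (p + 1)
    have hi := integrable_pow_radial p
    have hif : Integrable (fun r : ℝ => r ^ p • f r) radial := by
      refine hi.norm.mul_const C |>.mono' (hi.1.smul hf) (.of_forall fun r => ?_)
      rw [norm_smul]
      exact mul_le_mul_of_nonneg_left (hC r) (norm_nonneg _)
    have e1 : (moment (p + 1))⁻¹ • ∫ r, r ^ p • f r ∂radial - L
        = (moment (p + 1))⁻¹ • ∫ r, r ^ p • (f r - L) ∂radial := by
      simp only [smul_sub]
      rw [integral_sub hif (hi.smul_const L), integral_smul_const, integral_pow_radial, smul_sub,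
        smul_smul, inv_mul_cancel₀ hm.ne', one_smul]
    have hbi : Integrable (fun r : ℝ => ε / 2 * r ^ p + (C + ‖L‖) * |R| ^ p) radial :=
      (hi.const_mul _).add (integrable_const _)
    have e2 : ‖∫ r, r ^ p • (f r - L) ∂radial‖ ≤ ε / 2 * moment (p + 1) + (C + ‖L‖) * |R| ^ p := by
      refine (norm_integral_le_of_norm_le hbi ?_).trans_eq ?_
      · filter_upwards [ae_radial_pos, hB] with r hr hrB
        rw [norm_smul, Real.norm_of_nonneg (by positivity)]
        rcases le_or_gt R r with h | h
        · have h3 : r ∈ A ∩ B := ⟨hR r h, hrB⟩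
          rw [← hAB] at h3
          have h4 : ‖f r - L‖ < ε / 2 := by
            rw [← dist_eq_norm]
            exact h3
          have : 0 ≤ (C + ‖L‖) * |R| ^ p := by positivity
          have : r ^ p * ‖f r - L‖ ≤ r ^ p * (ε / 2) := by gcongr
          linarith
        · have h5 : r ≤ |R| := h.le.trans (le_abs_self R)
          have h6 : ‖f r - L‖ ≤ C + ‖L‖ := (norm_sub_le _ _).trans (by gcongr; exact hC r)
          have : 0 ≤ ε / 2 * r ^ p := by positivity
          have : r ^ p * ‖f r - L‖ ≤ |R| ^ p * (C + ‖L‖) := by gcongr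
          linarith
      · rw [integral_add (hi.const_mul _) (integrable_const _), integral_const_mul,
          integral_pow_radial]
        simp
    rw [e1, norm_smul, norm_inv, Real.norm_of_nonneg hm.le, inv_mul_le_iff₀ hm]
    refine e2.trans_eq ?_
    field_simp
  have h3 : Tendsto (fun p => ε / 2 + (C + ‖L‖) * (|R| ^ p / moment (p + 1))) atTop
      (𝓝 (ε / 2 + (C + ‖L‖) * 0)) := ((tendsto_pow_div_moment |R|).const_mul _).const_add _
  filter_upwards [h3.eventually_lt_const (u := ε) (by linarith)] with p hp
  rw [dist_eq_norm]
  exact (h2 p).trans_lt hp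

instance : (atTop ⊓ ae radial : Filter ℝ).NeBot := by
  refine ⟨fun h => ?_⟩
  -- otherwise the zero function would be averaged to every limit
  have h1 := tendsto_integral_radial (f := fun _ => 0) aestronglyMeasurable_const (C := 0)
    (by simp) (L := 1) (by rw [h]; exact tendsto_bot)
  simp only [smul_zero, integral_zero] at h1
  exact zero_ne_one (tendsto_nhds_unique tendsto_const_nhds h1)

/-- `H` is a bounded measurable function of `(θ, r)` with limit `h θ` as `r → ∞`, for almost every
angle `θ` and off a null set of radii. -/
structure HasAngularLimit (H : ℝ × ℝ → ℂ) (h : ℝ → ℂ) : Prop where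
  measurable : Measurable H
  bounded : ∃ C, ∀ q, ‖H q‖ ≤ C
  tendsto : ∀ᵐ θ ∂angular, Tendsto (fun r => H (θ, r)) (atTop ⊓ ae radial) (𝓝 (h θ))

namespace HasAngularLimit

variable {H : ℝ × ℝ → ℂ} {h : ℝ → ℂ}

lemma ae_tendsto_integral (hH : HasAngularLimit H h) : ∀ᵐ θ ∂angular,
    Tendsto (fun p : ℕ => (moment (p + 1))⁻¹ • ∫ r, r ^ p • H (θ, r) ∂radial) atTop (𝓝 (h θ)) := by
  obtain ⟨C, hC⟩ := hH.bounded
  have hm := hH.measurable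
  filter_upwards [hH.tendsto] with θ hθ
  exact tendsto_integral_radial (hm.comp measurable_prodMk_left).aestronglyMeasurable
    (fun r => hC _) hθ

lemma aestronglyMeasurable_integral (hH : HasAngularLimit H h) (p : ℕ) : AEStronglyMeasurable
    (fun θ => (moment (p + 1))⁻¹ • ∫ r, r ^ p • H (θ, r) ∂radial) angular := by
  have hm := hH.measurable
  have h1 : StronglyMeasurable fun q : ℝ × ℝ => q.2 ^ p • H q :=
    ((measurable_snd.pow_const p).smul hm).stronglyMeasurable
  exact (h1.integral_prod_right'.const_smul (moment (p + 1))⁻¹).aestronglyMeasurable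

lemma aestronglyMeasurable (hH : HasAngularLimit H h) : AEStronglyMeasurable h angular :=
  aestronglyMeasurable_of_tendsto_ae atTop hH.aestronglyMeasurable_integral hH.ae_tendsto_integral

lemma integrable_weighted (hH : HasAngularLimit H h) (p : ℕ) :
    Integrable (fun q : ℝ × ℝ => q.2 ^ p • H q) (angular.prod radial) := by
  obtain ⟨C, hC⟩ := hH.bounded
  have hm := hH.measurable
  refine ((integrable_pow_radial p).comp_snd angular).norm.mul_const C |>.mono'
    ((measurable_snd.pow_const p).smul hm).aestronglyMeasurable (.of_forall fun q => ?_)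
  rw [norm_smul]
  exact mul_le_mul_of_nonneg_left (hC q) (norm_nonneg _)

/-- The weighted averages of `H` over the plane converge to the mean of its angular limit. -/
lemma tendsto_integral (hH : HasAngularLimit H h) :
    Tendsto (fun p : ℕ => (moment (p + 1))⁻¹ • ∫ q, q.2 ^ p • H q ∂(angular.prod radial)) atTop
      (𝓝 (∫ θ, h θ ∂angular)) := by
  obtain ⟨C, hC⟩ := hH.bounded
  have hlim := tendsto_integral_of_dominated_convergence (fun _ => C)
    hH.aestronglyMeasurable_integral (integrable_const C) (fun p => .of_forall fun θ => ?_)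
    hH.ae_tendsto_integral
  · refine hlim.congr fun p => ?_
    rw [integral_smul, integral_prod _ (hH.integrable_weighted p)]
  · have hm := moment_pos (p + 1)
    rw [norm_smul, norm_inv, Real.norm_of_nonneg hm.le, inv_mul_le_iff₀ hm, mul_comm,
      ← integral_pow_radial, ← integral_const_mul]
    refine norm_integral_le_of_norm_le ((integrable_pow_radial p).const_mul _) ?_
    filter_upwards [ae_radial_pos] with r hr
    rw [norm_smul, Real.norm_of_nonneg (by positivity), mul_comm]
    exact mul_le_mul_of_nonneg_right (hC _) (by positivity)

lemma mul {G : ℝ × ℝ → ℂ} {g : ℝ → ℂ} (hH : HasAngularLimit H h) (hG : HasAngularLimit G g) :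
    HasAngularLimit (fun q => H q * G q) fun θ => h θ * g θ := by
  obtain ⟨C, hC⟩ := hH.bounded
  obtain ⟨D, hD⟩ := hG.bounded
  refine ⟨hH.measurable.mul hG.measurable, ⟨C * D, fun q => ?_⟩, ?_⟩
  · rw [norm_mul]
    exact mul_le_mul (hC q) (hD q) (norm_nonneg _) ((norm_nonneg _).trans (hC q))
  · filter_upwards [hH.tendsto, hG.tendsto] with θ h1 h2
    exact h1.mul h2

lemma of_angle {g : ℝ → ℂ} (hg : Measurable g) {C : ℝ} (hC : ∀ θ, ‖g θ‖ ≤ C) :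
    HasAngularLimit (fun q => g q.1) g :=
  ⟨hg.comp measurable_fst, ⟨C, fun _ => hC _⟩, .of_forall fun _ => tendsto_const_nhds⟩

lemma pow (hH : HasAngularLimit H h) (k : ℕ) :
    HasAngularLimit (fun q => H q ^ k) fun θ => h θ ^ k := by
  induction k with
  | zero => simpa using of_angle (g := fun _ => 1) measurable_const (C := 1) (by simp)
  | succ k ih => simpa only [pow_succ] using ih.mul hH

end HasAngularLimit

/-! ### Bounded real symbols -/

/-- `s` is a measurable representative of the symbol `σ` with values in `[a, b]`, and its limit
along almost every ray, off a null set of radii, is `σt`. -/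
structure IsRepresentative (σ : ℂ → ℝ) (σt : ℝ → ℝ) (a b : ℝ) (s : ℂ → ℝ) : Prop where
  measurable : Measurable s
  mem_Icc : ∀ z, s z ∈ Set.Icc a b
  ae_eq : σ =ᵐ[gaussian] s
  tendsto : ∀ᵐ θ ∂angular,
    Tendsto (fun r => s (polarMap (θ, r))) (atTop ⊓ ae radial) (𝓝 (σt θ))

lemma exists_ae_abs_le {σ : ℂ → ℝ} (hσ : MemLp σ ∞ gaussian) :
    ∃ C, ∀ᵐ z ∂gaussian, |σ z| ≤ C := by
  refine ⟨(eLpNormEssSup σ gaussian).toReal, ?_⟩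
  have h1 : eLpNormEssSup σ gaussian ≠ ∞ := by
    have := hσ.2
    rw [eLpNorm_exponent_top] at this
    exact this.ne
  filter_upwards [ae_le_eLpNormEssSup (f := σ) (μ := gaussian)] with z hz
  rw [← Real.norm_eq_abs, ← toReal_enorm]
  exact ENNReal.toReal_mono h1 hz

lemma ae_mem_Icc_essInf_essSup {σ : ℂ → ℝ} (hσ : MemLp σ ∞ gaussian) :
    ∀ᵐ z ∂gaussian, σ z ∈ Set.Icc (essInf σ gaussian) (essSup σ gaussian) := by
  obtain ⟨C, hC⟩ := exists_ae_abs_le hσ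
  have h1 : IsBoundedUnder (· ≤ ·) (ae gaussian) σ :=
    isBoundedUnder_of_eventually_le (hC.mono fun z hz => (_root_.abs_le.1 hz).2)
  have h2 : IsBoundedUnder (· ≥ ·) (ae gaussian) σ :=
    isBoundedUnder_of_eventually_ge (hC.mono fun z hz => (_root_.abs_le.1 hz).1)
  filter_upwards [ae_essInf_le h2, ae_le_essSup h1] with z h3 h4
  exact ⟨h3, h4⟩

lemma essInf_le_essSup {σ : ℂ → ℝ} (hσ : MemLp σ ∞ gaussian) :
    essInf σ gaussian ≤ essSup σ gaussian := by
  obtain ⟨z, hz⟩ := (ae_mem_Icc_essInf_essSup hσ).exists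
  exact hz.1.trans hz.2

/-- Almost every ray meets the exceptional null set of a measurable modification of `σ`, truncated to
its essential range, in a null set of radii. -/
lemma exists_isRepresentative {σ : ℂ → ℝ} (hσ : MemLp σ ∞ gaussian) {σt : ℝ → ℝ}
    (hlim : HasRadialLimit σ σt) :
    ∃ s, IsRepresentative σ σt (essInf σ gaussian) (essSup σ gaussian) s := by
  have hab := essInf_le_essSup hσ
  set a := essInf σ gaussian
  set b := essSup σ gaussian
  set σ₀ := hσ.1.mk σ
  have hm : Measurable σ₀ := hσ.1.stronglyMeasurable_mk.measurable
  have heq : σ =ᵐ[gaussian] fun z => max a (min b (σ₀ z)) := by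
    filter_upwards [hσ.1.ae_eq_mk, ae_mem_Icc_essInf_essSup hσ] with z h1 h2
    rw [← show σ z = σ₀ z from h1, min_eq_right h2.2, max_eq_right h2.1]
  refine ⟨fun z => max a (min b (σ₀ z)), by fun_prop,
    fun z => ⟨le_max_left _ _, max_le hab (min_le_left _ _)⟩, heq, ?_⟩
  have h1 : ∀ᵐ θ ∂angular, ∀ᵐ r ∂radial,
      σ (polarMap (θ, r)) = max a (min b (σ₀ (polarMap (θ, r)))) :=
    Measure.ae_ae_of_ae_prod (measurePreserving_polarMap.quasiMeasurePreserving.ae heq)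
  have h2 : ∀ᵐ θ ∂angular, Tendsto (fun r : ℝ => σ (polarMap (θ, r))) atTop (𝓝 (σt θ)) := by
    rw [ae_angular_iff, ← restrict_Ioo_eq_restrict_Ioc, restrict_Ioo_eq_restrict_Ico]
    exact hlim
  filter_upwards [h1, h2] with θ h3 h4
  exact (h4.mono_left inf_le_left).congr' (mem_inf_of_right h3)

namespace IsRepresentative

variable {σ : ℂ → ℝ} {σt : ℝ → ℝ} {a b : ℝ} {s : ℂ → ℝ}

lemma abs_le (hs : IsRepresentative σ σt a b s) (z : ℂ) : |s z| ≤ max |a| |b| :=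
  abs_le_max_abs_abs (hs.mem_Icc z).1 (hs.mem_Icc z).2

lemma hasAngularLimit (hs : IsRepresentative σ σt a b s) :
    HasAngularLimit (fun q => (s (polarMap q) : ℂ)) fun θ => (σt θ : ℂ) := by
  have h1 := hs.measurable
  have h2 := continuous_polarMap.measurable
  refine ⟨by fun_prop, ⟨max |a| |b|, fun q => ?_⟩, ?_⟩
  · rw [Complex.norm_real]
    exact hs.abs_le _
  · filter_upwards [hs.tendsto] with θ hθ
    exact (Complex.continuous_ofReal.tendsto _).comp hθ

lemma aemeasurable (hs : IsRepresentative σ σt a b s) : AEMeasurable σt angular :=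
  (Complex.measurable_re.comp_aemeasurable hs.hasAngularLimit.aestronglyMeasurable.aemeasurable)

lemma ae_mem_Icc (hs : IsRepresentative σ σt a b s) : ∀ᵐ θ ∂angular, σt θ ∈ Set.Icc a b := by
  filter_upwards [hs.tendsto] with θ hθ
  exact isClosed_Icc.mem_of_tendsto hθ (.of_forall fun r => hs.mem_Icc _)

end IsRepresentative

/-! ### Characters of the circle and Parseval's identity -/

/-- The character `e^{ikθ}`. -/
def character (k : ℤ) (θ : ℝ) : ℂ := Complex.exp ((k * θ : ℝ) * Complex.I)

lemma continuous_character (k : ℤ) : Continuous (character k) := by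
  unfold character; fun_prop

lemma norm_character (k : ℤ) (θ : ℝ) : ‖character k θ‖ = 1 :=
  Complex.norm_exp_ofReal_mul_I _

@[simp] lemma character_zero (θ : ℝ) : character 0 θ = 1 := by simp [character]

lemma integral_character {k : ℤ} (hk : k ≠ 0) : ∫ θ, character k θ ∂angular = 0 := by
  have hc : (k * Complex.I : ℂ) ≠ 0 := mul_ne_zero (by exact_mod_cast hk) Complex.I_ne_zero
  have h1 : ∀ θ, character k θ = Complex.exp (k * Complex.I * θ) := fun θ => by
    rw [character]; push_cast; ring_nf
  simp only [integral_angular, h1, integral_exp_mul_complex hc]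
  have h2 : Complex.exp (k * Complex.I * (2 * Real.pi : ℝ)) = 1 := by
    rw [← Complex.exp_int_mul_two_pi_mul_I k]
    congr 1; push_cast; ring
  rw [h2]
  simp

/-- Parseval's identity. -/
lemma hasSum_sq_integral_mul_character {h : ℝ → ℂ} (hh : MemLp h 2 angular) :
    HasSum (fun k : ℤ => ‖∫ θ, h θ * character k θ ∂angular‖ ^ 2) (∫ θ, ‖h θ‖ ^ 2 ∂angular) := by
  have h0 : MemLp h 2 (volume.restrict (Set.Ioc 0 (2 * Real.pi))) := by
    have h1 : volume.restrict (Set.Ioc 0 (2 * Real.pi))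
        = ENNReal.ofReal (2 * Real.pi) • angular := by
      rw [angular, smul_smul, ← ENNReal.ofReal_mul (by positivity),
        mul_inv_cancel₀ (by positivity), ENNReal.ofReal_one, one_smul]
    rw [h1]
    exact hh.smul_measure ENNReal.ofReal_ne_top
  have h2 := hasSum_sq_fourierCoeffOn Real.two_pi_pos h0
  rw [sub_zero, ← integral_angular, ← (Equiv.neg ℤ).hasSum_iff] at h2
  convert h2 using 2 with k
  simp only [Function.comp_apply, Equiv.neg_apply]
  rw [fourierCoeffOn_eq_integral, integral_angular, neg_neg, sub_zero, one_div]
  congr 3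
  refine intervalIntegral.integral_congr fun θ _ => ?_
  simp only [smul_eq_mul]
  rw [fourier_coe_apply, character, mul_comm]
  congr 2
  have := Real.pi_ne_zero
  push_cast
  field_simp

/-! ### Matrix coefficients -/

lemma coeFn_monomial (n : ℕ) :
    (monomial n : Lp ℂ 2 gaussian) =ᵐ[gaussian] fun z => z ^ n / (√(n ! : ℝ) : ℂ) :=
  (memLp_monomial n).coeFn_toLp

lemma polarMap_pow_mul_conj_pow (q : ℝ × ℝ) (m n : ℕ) :
    polarMap q ^ m * (starRingEnd ℂ) (polarMap q) ^ n
      = (q.2 : ℂ) ^ (m + n) * character (m - n) q.1 := by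
  have h : (starRingEnd ℂ) (polarMap q) = q.2 * Complex.exp (-(q.1 * Complex.I)) := by
    rw [polarMap, map_mul, Complex.conj_ofReal, ← Complex.exp_conj]
    simp
  rw [h, polarMap, mul_pow, mul_pow, ← Complex.exp_nat_mul, ← Complex.exp_nat_mul,
    mul_mul_mul_comm, ← pow_add, ← Complex.exp_add, character]
  congr 2
  push_cast
  ring

/-- Matrix coefficients of multiplication by `g`, in polar coordinates. -/
lemma inner_monomial_eq_integral {f : Lp ℂ 2 gaussian} {g : ℂ → ℂ} (hg : Measurable g) (m n : ℕ)
    (hf : f =ᵐ[gaussian] fun z => g z * (monomial m : Lp ℂ 2 gaussian) z) :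
    inner ℂ (monomial n : Lp ℂ 2 gaussian) f
      = (√(n ! : ℝ) * √(m ! : ℝ))⁻¹ • ∫ q, q.2 ^ (m + n) • (g (polarMap q) * character (m - n) q.1)
          ∂(angular.prod radial) := by
  have e1 : inner ℂ (monomial n : Lp ℂ 2 gaussian) f
      = ∫ z, (√(n ! : ℝ) * √(m ! : ℝ))⁻¹ • (g z * (z ^ m * (starRingEnd ℂ) z ^ n)) ∂gaussian := by
    rw [L2.inner_def]
    refine integral_congr_ae ?_
    filter_upwards [hf, coeFn_monomial m, coeFn_monomial n] with z h1 h2 h3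
    rw [h1, h2, h3, RCLike.inner_apply, Complex.real_smul]
    simp only [map_div₀, map_pow, Complex.conj_ofReal]
    push_cast
    rw [div_eq_mul_inv, div_eq_mul_inv, mul_inv]
    ring
  have hm := continuous_polarMap.measurable
  rw [e1, integral_smul, ← measurePreserving_polarMap.map_eq, integral_map hm.aemeasurable
    (by fun_prop)]
  congr 1
  refine integral_congr_ae (.of_forall fun q => ?_)
  simp only [polarMap_pow_mul_conj_pow, Complex.real_smul]
  push_cast
  ring

lemma orthonormal_monomial : Orthonormal ℂ fun n => (monomial n : Lp ℂ 2 gaussian) := by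
  rw [orthonormal_iff_ite]
  intro n m
  have h := inner_monomial_eq_integral (f := monomial m) (g := fun _ => 1) measurable_const m n
    (.of_forall fun z => by simp)
  have h2 : ∫ q, q.2 ^ (m + n) • ((1 : ℂ) * character (m - n) q.1) ∂(angular.prod radial)
      = (∫ θ, character (m - n) θ ∂angular) * (moment (m + n + 1) : ℂ) := by
    rw [← integral_pow_radial, ← integral_complex_ofReal, ← integral_prod_mul]
    refine integral_congr_ae (.of_forall fun q => ?_)
    simp only [one_mul, Complex.real_smul]
    rw [mul_comm]
  rw [h, h2]
  split_ifs with hnm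
  · subst hnm
    rw [← two_mul, moment_two_mul_add_one, Real.mul_self_sqrt (by positivity)]
    have : (n ! : ℂ) ≠ 0 := by exact_mod_cast n.factorial_ne_zero
    simp [this]
  · rw [integral_character (by rw [sub_ne_zero]; exact_mod_cast Ne.symm hnm), zero_mul, smul_zero]

variable {σ : ℂ → ℝ} {σt : ℝ → ℝ} {a b : ℝ} {s : ℂ → ℝ}

lemma coeFn_mulOp_realSymbol (hσ : MemLp σ ∞ gaussian) (hs : IsRepresentative σ σt a b s)
    (f : Lp ℂ 2 gaussian) :
    mulOp (realSymbol σ hσ) f =ᵐ[gaussian] fun z => (s z : ℂ) * f z := by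
  filter_upwards [coeFn_mulOp (realSymbol σ hσ) f, (hσ.ofReal (K := ℂ)).coeFn_toLp, hs.ae_eq]
    with z h1 h2 h3
  have h4 : realSymbol σ hσ z = (σ z : ℂ) := h2
  rw [h1, h4, h3]

lemma coeFn_mulOp_pow (hσ : MemLp σ ∞ gaussian) (hs : IsRepresentative σ σt a b s) (j : ℕ)
    (f : Lp ℂ 2 gaussian) :
    (mulOp (realSymbol σ hσ) ^ j) f =ᵐ[gaussian] fun z => (s z : ℂ) ^ j * f z := by
  induction j with
  | zero => simp
  | succ j ih =>
    rw [pow_succ', mul_apply_eq_comp]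
    filter_upwards [ih, coeFn_mulOp_realSymbol hσ hs ((mulOp (realSymbol σ hσ) ^ j) f)] with z h1 h2
    rw [h2, h1, pow_succ']
    ring

lemma isSelfAdjoint_mulOp (hσ : MemLp σ ∞ gaussian) : IsSelfAdjoint (mulOp (realSymbol σ hσ)) := by
  rw [ContinuousLinearMap.isSelfAdjoint_iff_isSymmetric]
  intro f g
  simp only [ContinuousLinearMap.coe_coe]
  rw [L2.inner_def, L2.inner_def]
  refine integral_congr_ae ?_
  filter_upwards [coeFn_mulOp (realSymbol σ hσ) f, coeFn_mulOp (realSymbol σ hσ) g,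
    (hσ.ofReal (K := ℂ)).coeFn_toLp] with z h1 h2 h3
  have h3' : realSymbol σ hσ z = (σ z : ℂ) := h3
  rw [h1, h2, h3']
  simp [mul_assoc, mul_left_comm]

lemma tendsto_moment_div_factorial (i l : ℕ) : Tendsto (fun m : ℕ => moment (2 * m + i + l + 1) /
    (√((m + i) ! : ℝ) * √((m + l) ! : ℝ))) atTop (𝓝 1) := by
  wlog h : i ≤ l generalizing i l
  · refine (this l i (le_of_not_ge h)).congr fun m => ?_
    rw [mul_comm (√((m + l) ! : ℝ)), add_right_comm (2 * m)]
  obtain ⟨d, rfl⟩ := Nat.exists_eq_add_of_le h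
  refine ((tendsto_moment_sq_div d).comp (tendsto_atTop_mono (f := id)
    (g := fun m => 2 * (m + i) + 1) (fun m => by simp only [id]; omega) tendsto_id)).congr fun m => ?_
  simp only [Function.comp_apply]
  rw [← moment_two_mul_add_one, ← moment_two_mul_add_one, mul_comm (√(moment (2 * (m + i) + 1))),
    show 2 * m + i + (i + d) + 1 = 2 * (m + i) + 1 + d by ring,
    show 2 * (m + (i + d)) + 1 = 2 * (m + i) + 1 + 2 * d by ring]

/-- Far from the corner, the matrix of multiplication by `σ^j` is asymptotically the Toeplitz matrix
of the Fourier coefficients of `σt^j`. -/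
lemma tendsto_inner_monomial (hσ : MemLp σ ∞ gaussian) (hs : IsRepresentative σ σt a b s)
    (j i l : ℕ) :
    Tendsto (fun m : ℕ => inner ℂ (monomial (m + i) : Lp ℂ 2 gaussian)
        ((mulOp (realSymbol σ hσ) ^ j) (monomial (m + l)))) atTop
      (𝓝 (∫ θ, (σt θ : ℂ) ^ j * character (l - i) θ ∂angular)) := by
  have h1 := ((hs.hasAngularLimit.pow j).mul (.of_angle (continuous_character (l - i)).measurable
    fun θ => (norm_character _ θ).le)).tendsto_integral
  have hsm := hs.measurable
  have h2 := (tendsto_moment_div_factorial i l).smul (h1.comp (tendsto_atTop_mono (f := id)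
    (g := fun m => 2 * m + i + l) (fun m => by simp only [id]; omega) tendsto_id))
  rw [one_smul] at h2
  refine h2.congr fun m => ?_
  rw [inner_monomial_eq_integral (g := fun z => (s z : ℂ) ^ j) (by fun_prop) (m + l) (m + i)
    (coeFn_mulOp_pow hσ hs j _)]
  have hm := (moment_pos (2 * m + i + l + 1)).ne'
  simp only [Function.comp_apply, smul_smul]
  congr 1
  · field_simp
  · refine integral_congr_ae (.of_forall fun q => ?_)
    simp only
    congr 2
    · ring
    · rw [show ((m + l : ℕ) : ℤ) - ((m + i : ℕ) : ℤ) = l - i by push_cast; ring]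

/-! ### The projection of `L²` onto `K_N` -/

/-- The orthogonal projection of `L²` onto `K_N`, as an operator on `L²`. -/
def projK (N : ℕ) : Lp ℂ 2 gaussian →L[ℂ] Lp ℂ 2 gaussian :=
  space.subtypeL ∘L (K N).subtypeL ∘L (K N).orthogonalProjectionOnto ∘L
    space.orthogonalProjectionOnto

lemma norm_projK_apply_le (N : ℕ) (v : Lp ℂ 2 gaussian) : ‖projK N v‖ ≤ ‖v‖ := by
  refine ((K N).norm_orthogonalProjectionOnto_apply_le (space.orthogonalProjectionOnto v)).trans ?_
  exact space.norm_orthogonalProjectionOnto_apply_le v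

lemma inner_projK (N : ℕ) (u : K N) (v : Lp ℂ 2 gaussian) :
    inner ℂ ((u : space) : Lp ℂ 2 gaussian) (projK N v)
      = inner ℂ ((u : space) : Lp ℂ 2 gaussian) v := by
  rw [← Submodule.inner_orthogonalProjectionOnto_eq_of_mem_left (u : space) v,
    ← Submodule.inner_orthogonalProjectionOnto_eq_of_mem_left u]
  rfl

lemma norm_sub_projK_sq (N : ℕ) (v : Lp ℂ 2 gaussian) :
    ‖v - projK N v‖ ^ 2 = ‖v‖ ^ 2 - ‖projK N v‖ ^ 2 := by
  have h1 : inner ℂ (projK N v) (projK N v) = inner ℂ (projK N v) v :=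
    inner_projK N ((K N).orthogonalProjectionOnto (space.orthogonalProjectionOnto v)) v
  have h2 : inner ℂ (v - projK N v) (projK N v) = 0 := by
    rw [← inner_conj_symm, inner_sub_right, h1, sub_self, map_zero]
  have h3 := norm_add_sq_eq_norm_sq_add_norm_sq_of_inner_eq_zero _ _ h2
  rw [sub_add_cancel] at h3
  nlinarith

/-- The basis vector `zⁿ / √(n!)` of `K_N`, for `n ≤ N`. -/
def monomialK {N n : ℕ} (h : n ≤ N) : K N :=
  ⟨monomial n, Submodule.subset_span ⟨⟨n, Nat.lt_succ_of_le h⟩, rfl⟩⟩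

/-- Bessel's inequality for the distance to `K_N`. -/
lemma norm_sub_projK_sq_le (N m d : ℕ) (h : ∀ i < d, m + i ≤ N) (v : Lp ℂ 2 gaussian) :
    ‖v - projK N v‖ ^ 2 ≤ ‖v‖ ^ 2
      - ∑ i ∈ Finset.range d, ‖inner ℂ (monomial (m + i) : Lp ℂ 2 gaussian) v‖ ^ 2 := by
  have h1 := (orthonormal_monomial.comp (fun i => m + i)
    (add_right_injective m)).sum_inner_products_le (x := projK N v) (s := Finset.range d)
  have h2 : ∀ i ∈ Finset.range d,
      ‖inner ℂ (monomial (m + i) : Lp ℂ 2 gaussian) (projK N v)‖ ^ 2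
        = ‖inner ℂ (monomial (m + i) : Lp ℂ 2 gaussian) v‖ ^ 2 := fun i hi => by
    exact congrArg (fun x : ℂ => ‖x‖ ^ 2)
      (inner_projK N (monomialK (h i (Finset.mem_range.1 hi))) v)
  simp only [Function.comp_apply] at h1
  rw [Finset.sum_congr rfl h2] at h1
  rw [norm_sub_projK_sq]
  linarith

/-! ### Compressions in the bulk -/

/-- Pairs `(N, m)` with `m` tending away from both ends of `{0, …, N}`. -/
def bulk : Filter (ℕ × ℕ) := comap (fun p => min p.2 (p.1 - p.2)) atTop

lemma eventually_bulk_iff {P : ℕ × ℕ → Prop} :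
    (∀ᶠ p in bulk, P p) ↔ ∃ T, ∀ N m, T ≤ m → m + T ≤ N → P (N, m) := by
  rw [bulk, eventually_comap, eventually_atTop]
  constructor
  · rintro ⟨T, hT⟩
    exact ⟨T, fun N m h1 h2 => hT _ (le_min h1 (Nat.le_sub_of_add_le' h2)) (N, m) rfl⟩
  · rintro ⟨T, hT⟩
    refine ⟨T + 1, fun t ht p hp => hT p.1 p.2 ?_ ?_⟩ <;> omega

lemma tendsto_snd_bulk : Tendsto (fun p : ℕ × ℕ => p.2) bulk atTop :=
  tendsto_atTop_mono (fun _ => min_le_left _ _) tendsto_comap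

/-- Cesàro means only see the bulk. -/
lemma tendsto_average_of_bulk {x : ℕ × ℕ → ℂ} {L : ℂ} (hx : Tendsto x bulk (𝓝 L)) {B : ℝ}
    (hB : ∀ p, ‖x p‖ ≤ B) :
    Tendsto (fun N : ℕ => (N + 1 : ℂ)⁻¹ * ∑ m ∈ Finset.range (N + 1), x (N, m)) atTop (𝓝 L) := by
  rw [Metric.tendsto_nhds]
  intro ε hε
  obtain ⟨T, hT⟩ := eventually_bulk_iff.1 (Metric.tendsto_nhds.1 hx (ε / 2) (by positivity))
  set D := B + ‖L‖
  have hD : ∀ p, ‖x p - L‖ ≤ D := fun p => (norm_sub_le _ _).trans (add_le_add_left (hB p) _)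
  have hD0 : 0 ≤ D := (norm_nonneg _).trans (hD (0, 0))
  have h1 : ∀ N : ℕ, ‖(N + 1 : ℂ)⁻¹ * ∑ m ∈ Finset.range (N + 1), x (N, m) - L‖
      ≤ ε / 2 + 2 * T * D * (1 / ((N : ℝ) + 1)) := by
    intro N
    have hN : (N + 1 : ℂ) ≠ 0 := by exact_mod_cast N.succ_ne_zero
    have e1 : (N + 1 : ℂ)⁻¹ * ∑ m ∈ Finset.range (N + 1), x (N, m) - L
        = (N + 1 : ℂ)⁻¹ * ∑ m ∈ Finset.range (N + 1), (x (N, m) - L) := by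
      rw [Finset.sum_sub_distrib, Finset.sum_const, Finset.card_range, nsmul_eq_mul]
      push_cast
      rw [mul_sub, inv_mul_cancel_left₀ hN]
    have e2 : ‖∑ m ∈ Finset.range (N + 1), (x (N, m) - L)‖ ≤ (N + 1) * (ε / 2) + 2 * T * D := by
      have hcard : ((Finset.range (N + 1)).filter fun m => ¬(T ≤ m ∧ m + T ≤ N)).card ≤ 2 * T := by
        have hsub : ((Finset.range (N + 1)).filter fun m => ¬(T ≤ m ∧ m + T ≤ N))
            ⊆ Finset.range T ∪ (Finset.range T).image fun i => N - i := by
          intro m hm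
          simp only [Finset.mem_filter, Finset.mem_range, Finset.mem_union, Finset.mem_image] at hm ⊢
          by_cases h : m < T
          · exact Or.inl h
          · exact Or.inr ⟨N - m, by omega, by omega⟩
        refine (Finset.card_le_card hsub).trans ((Finset.card_union_le _ _).trans ?_)
        have := Finset.card_image_le (s := Finset.range T) (f := fun i => N - i)
        rw [Finset.card_range] at this ⊢
        omega
      rw [← Finset.sum_filter_add_sum_filter_not _ fun m => T ≤ m ∧ m + T ≤ N]
      refine (norm_add_le _ _).trans (add_le_add ?_ ?_)
      · refine (norm_sum_le_of_le _ (n := fun _ => ε / 2) fun m hm => ?_).trans ?_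
        · obtain ⟨-, h2, h3⟩ := Finset.mem_filter.1 hm
          rw [← dist_eq_norm]
          exact (hT N m h2 h3).le
        · rw [Finset.sum_const, nsmul_eq_mul]
          have : (((Finset.range (N + 1)).filter fun m => T ≤ m ∧ m + T ≤ N).card : ℝ) ≤ N + 1 := by
            have := Finset.card_filter_le (Finset.range (N + 1)) fun m => T ≤ m ∧ m + T ≤ N
            rw [Finset.card_range] at this
            exact_mod_cast this
          gcongr
      · refine (norm_sum_le_of_le _ (n := fun _ => D) fun m _ => hD _).trans ?_
        rw [Finset.sum_const, nsmul_eq_mul]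
        gcongr
        exact_mod_cast hcard
    have hN0 : (0 : ℝ) < N + 1 := by positivity
    have e3 : ‖(N + 1 : ℂ)⁻¹‖ = ((N : ℝ) + 1)⁻¹ := by
      rw [norm_inv]
      congr 1
      exact_mod_cast Complex.norm_natCast (N + 1)
    rw [e1, norm_mul, e3, inv_mul_le_iff₀ hN0]
    refine e2.trans_eq ?_
    field_simp
  have h2 : Tendsto (fun N : ℕ => ε / 2 + 2 * T * D * (1 / ((N : ℝ) + 1))) atTop
      (𝓝 (ε / 2 + 2 * T * D * 0)) :=
    (tendsto_one_div_add_atTop_nhds_zero_nat.const_mul _).const_add _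
  filter_upwards [h2.eventually_lt_const (u := ε) (by linarith)] with N hN
  rw [dist_eq_norm]
  exact (h1 N).trans_lt hN

lemma memLp_pow_limit (hs : IsRepresentative σ σt a b s) (j : ℕ) :
    MemLp (fun θ => (σt θ : ℂ) ^ j) 2 angular := by
  refine MemLp.of_bound (hs.hasAngularLimit.pow j).aestronglyMeasurable (max |a| |b| ^ j) ?_
  filter_upwards [hs.ae_mem_Icc] with θ hθ
  rw [norm_pow, Complex.norm_real, Real.norm_eq_abs]
  gcongr
  exact abs_le_max_abs_abs hθ.1 hθ.2

/-- In the bulk `σ^j zᵐ / √(m!)` is almost contained in `K_N`: by Parseval's identity its norm is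
exhausted by finitely many Fourier coefficients of `σt^j`, which sit at indices close to `m`. -/
lemma tendsto_norm_sub_projK (hσ : MemLp σ ∞ gaussian) (hs : IsRepresentative σ σt a b s) (j : ℕ) :
    Tendsto (fun p : ℕ × ℕ => ‖(mulOp (realSymbol σ hσ) ^ j) (monomial p.2)
      - projK p.1 ((mulOp (realSymbol σ hσ) ^ j) (monomial p.2))‖) bulk (𝓝 0) := by
  set M := mulOp (realSymbol σ hσ) with hM
  set t : ℤ → ℝ := fun k => ‖∫ θ, (σt θ : ℂ) ^ j * character k θ ∂angular‖ ^ 2 with ht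
  set E : ℝ := ∫ θ, ‖(σt θ : ℂ) ^ j‖ ^ 2 ∂angular with hE
  have hpars : HasSum t E := hasSum_sq_integral_mul_character (memLp_pow_limit hs j)
  have hsets : Tendsto (fun k : ℕ => (Finset.range (2 * k + 1)).image fun i : ℕ => (k - i : ℤ))
      atTop atTop := by
    refine tendsto_atTop_finset_of_monotone (fun k l hkl x hx => ?_) fun x => ⟨x.natAbs, ?_⟩
    · simp only [Finset.mem_image, Finset.mem_range] at hx ⊢
      obtain ⟨i, hi, rfl⟩ := hx
      exact ⟨l - k + i, by omega, by omega⟩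
    · simp only [Finset.mem_image, Finset.mem_range]
      exact ⟨(x.natAbs - x).toNat, by omega, by omega⟩
  have hpars2 : Tendsto (fun k : ℕ => ∑ i ∈ Finset.range (2 * k + 1), t (k - i)) atTop (𝓝 E) := by
    refine (hpars.comp hsets).congr fun k => ?_
    simp only [Function.comp_apply]
    rw [Finset.sum_image fun i _ l _ h => by simpa using h]
  -- the squared norm of `σ^j zᵐ / √(m!)` tends to the `L²` norm of `σt^j`
  have hnorm : Tendsto (fun m : ℕ => ‖(M ^ j) (monomial m : Lp ℂ 2 gaussian)‖ ^ 2) atTop (𝓝 E) := by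
    have h1 := (Complex.continuous_re.tendsto _).comp (tendsto_inner_monomial hσ hs (j + j) 0 0)
    have h2 : (∫ θ, (σt θ : ℂ) ^ (j + j) * character ((0 : ℕ) - (0 : ℕ)) θ ∂angular).re = E := by
      rw [hE, ← Complex.ofReal_re (∫ θ, ‖(σt θ : ℂ) ^ j‖ ^ 2 ∂angular), ← integral_complex_ofReal]
      congr 2
      funext θ
      rw [sub_self, character_zero, mul_one, norm_pow, Complex.norm_real, Real.norm_eq_abs,
        ← pow_mul, mul_comm, pow_mul, sq_abs, ← pow_mul]
      push_cast
      ring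
    rw [h2] at h1
    refine h1.congr fun m => ?_
    simp only [Function.comp_apply, add_zero]
    have h3 := ContinuousLinearMap.isSelfAdjoint_iff_isSymmetric.1 ((isSelfAdjoint_mulOp hσ).pow j)
    have h4 := h3 (monomial m : Lp ℂ 2 gaussian) ((M ^ j) (monomial m))
    simp only [ContinuousLinearMap.coe_coe] at h4
    rw [← hM] at h4 ⊢
    rw [pow_add, mul_apply_eq_comp, ← h4, ← inner_self_eq_norm_sq (𝕜 := ℂ)]
    rfl
  have key : Tendsto (fun p : ℕ × ℕ => ‖(M ^ j) (monomial p.2 : Lp ℂ 2 gaussian)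
      - projK p.1 ((M ^ j) (monomial p.2))‖ ^ 2) bulk (𝓝 0) := by
    rw [Metric.tendsto_nhds]
    intro ε hε
    obtain ⟨k, hk⟩ := (hpars2.eventually_const_lt (u := E - ε) (by linarith)).exists
    have h1 : Tendsto (fun m : ℕ => ‖(M ^ j) (monomial (m + k) : Lp ℂ 2 gaussian)‖ ^ 2
        - ∑ i ∈ Finset.range (2 * k + 1), ‖inner ℂ (monomial (m + i) : Lp ℂ 2 gaussian)
          ((M ^ j) (monomial (m + k)))‖ ^ 2) atTop
        (𝓝 (E - ∑ i ∈ Finset.range (2 * k + 1), t (k - i))) :=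
      (hnorm.comp (tendsto_add_atTop_nat k)).sub
        (tendsto_finsetSum _ fun i _ => (tendsto_inner_monomial hσ hs j i k).norm.pow 2)
    obtain ⟨m₀, hm₀⟩ := eventually_atTop.1 (h1.eventually_lt_const (u := ε) (by linarith))
    refine eventually_bulk_iff.2 ⟨m₀ + k, fun N m h2 h3 => ?_⟩
    rw [dist_zero_right, Real.norm_of_nonneg (by positivity)]
    have h4 := hm₀ (m - k) (by omega)
    rw [show m - k + k = m by omega] at h4
    exact (norm_sub_projK_sq_le N (m - k) (2 * k + 1) (fun i hi => by omega) _).trans_lt h4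
  have h5 := key.sqrt
  simpa only [Real.sqrt_zero, Real.sqrt_sq (norm_nonneg _)] using h5

/-- In the bulk, powers of the compression act like powers of the symbol. -/
lemma tendsto_norm_compression_pow_sub (hσ : MemLp σ ∞ gaussian)
    (hs : IsRepresentative σ σt a b s) (j : ℕ) :
    Tendsto (fun p : ℕ × ℕ => ‖((projK p.1 ∘L mulOp (realSymbol σ hσ)) ^ j) (monomial p.2)
      - (mulOp (realSymbol σ hσ) ^ j) (monomial p.2)‖) bulk (𝓝 0) := by
  set M := mulOp (realSymbol σ hσ) with hM
  induction j with
  | zero =>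
    simp only [pow_zero, sub_self, norm_zero]
    exact tendsto_const_nhds
  | succ j ih =>
    have h1 := (ih.const_mul ‖M‖).add (tendsto_norm_sub_projK hσ hs (j + 1))
    rw [mul_zero, add_zero] at h1
    refine squeeze_zero (fun _ => norm_nonneg _) (fun p => ?_) h1
    set v : Lp ℂ 2 gaussian := (monomial p.2 : Lp ℂ 2 gaussian)
    have e1 : ((projK p.1 ∘L M) ^ (j + 1)) v - (M ^ (j + 1)) v
        = projK p.1 (M (((projK p.1 ∘L M) ^ j) v - (M ^ j) v))
          - ((M ^ (j + 1)) v - projK p.1 ((M ^ (j + 1)) v)) := by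
      rw [pow_succ', pow_succ', mul_apply_eq_comp, mul_apply_eq_comp,
        ContinuousLinearMap.comp_apply, map_sub, map_sub]
      abel
    rw [e1]
    refine (norm_sub_le _ _).trans (add_le_add ?_ le_rfl)
    exact (norm_projK_apply_le _ _).trans (M.le_opNorm _)

lemma tendsto_inner_compression_pow (hσ : MemLp σ ∞ gaussian)
    (hs : IsRepresentative σ σt a b s) (j : ℕ) :
    Tendsto (fun p : ℕ × ℕ => inner ℂ (monomial p.2 : Lp ℂ 2 gaussian)
      (((projK p.1 ∘L mulOp (realSymbol σ hσ)) ^ j) (monomial p.2))) bulk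
      (𝓝 (∫ θ, (σt θ : ℂ) ^ j ∂angular)) := by
  have h1 := (tendsto_inner_monomial hσ hs j 0 0).comp tendsto_snd_bulk
  simp only [sub_self, character_zero, mul_one] at h1
  have h2 : Tendsto (fun p : ℕ × ℕ => inner ℂ (monomial p.2 : Lp ℂ 2 gaussian)
      (((projK p.1 ∘L mulOp (realSymbol σ hσ)) ^ j) (monomial p.2)
        - (mulOp (realSymbol σ hσ) ^ j) (monomial p.2))) bulk (𝓝 0) := by
    refine squeeze_zero_norm (fun p => ?_) (tendsto_norm_compression_pow_sub hσ hs j)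
    refine (norm_inner_le_norm _ _).trans_eq ?_
    rw [orthonormal_monomial.1, one_mul]
  have h3 := h2.add h1
  rw [zero_add] at h3
  refine h3.congr fun p => ?_
  simp only [Function.comp_apply, add_zero]
  rw [← inner_add_right, sub_add_cancel]

lemma norm_inner_compression_pow_le (hσ : MemLp σ ∞ gaussian) (j : ℕ) (p : ℕ × ℕ) :
    ‖inner ℂ (monomial p.2 : Lp ℂ 2 gaussian)
      (((projK p.1 ∘L mulOp (realSymbol σ hσ)) ^ j) (monomial p.2))‖
      ≤ ‖mulOp (realSymbol σ hσ)‖ ^ j := by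
  refine (norm_inner_le_norm _ _).trans ?_
  rw [orthonormal_monomial.1, one_mul]
  induction j with
  | zero => simp [orthonormal_monomial.1]
  | succ j ih =>
    rw [pow_succ', mul_apply_eq_comp, ContinuousLinearMap.comp_apply, pow_succ']
    refine (norm_projK_apply_le _ _).trans ((ContinuousLinearMap.le_opNorm _ _).trans ?_)
    gcongr

/-! ### Traces and eigenvalues of symmetric operators -/

section SymmetricOperator

variable {H : Type*} [NormedAddCommGroup H] [InnerProductSpace ℂ H] {A : H →L[ℂ] H} {n : ℕ}

lemma aeval_apply_of_apply_eq_smul {v : H} {c : ℂ} (h : A v = c • v) (p : Polynomial ℂ) :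
    (Polynomial.aeval A p) v = p.eval c • v := by
  induction p using Polynomial.induction_on with
  | C r => simp [Algebra.algebraMap_eq_smul_one]
  | add p q hp hq => simp [hp, hq, add_smul]
  | monomial n r ih =>
    rw [pow_succ, ← mul_assoc, map_mul, mul_apply_eq_comp, Polynomial.aeval_X, h, map_smul, ih,
      smul_smul, Polynomial.eval_mul (q := Polynomial.X), Polynomial.eval_X, mul_comm]

variable [FiniteDimensional ℂ H]

lemma trace_eq_sum_of_eigenvectorBasis (hA : A.toLinearMap.IsSymmetric)
    (hn : Module.finrank ℂ H = n) (B : H →L[ℂ] H) (c : Fin n → ℂ)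
    (hB : ∀ i, B (hA.eigenvectorBasis hn i) = c i • hA.eigenvectorBasis hn i) :
    LinearMap.trace ℂ H B.toLinearMap = ∑ i, c i := by
  rw [LinearMap.trace_eq_sum_inner _ (hA.eigenvectorBasis hn)]
  refine Finset.sum_congr rfl fun i _ => ?_
  rw [ContinuousLinearMap.coe_coe, hB, inner_smul_right, inner_self_eq_norm_sq_to_K,
    (hA.eigenvectorBasis hn).norm_eq_one]
  simp

lemma apply_eigenvectorBasis (hA : A.toLinearMap.IsSymmetric) (hn : Module.finrank ℂ H = n)
    (i : Fin n) :
    A (hA.eigenvectorBasis hn i) = (hA.eigenvalues hn i : ℂ) • hA.eigenvectorBasis hn i :=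
  hA.apply_eigenvectorBasis hn i

/-- The power sums of the eigenvalues, computed in any orthonormal basis and inside any larger
space. -/
lemma sum_eigenvalues_pow (hA : A.toLinearMap.IsSymmetric) (hn : Module.finrank ℂ H = n)
    {E : Type*} [NormedAddCommGroup E] [InnerProductSpace ℂ E] (ι : H →ₗᵢ[ℂ] E) (S : E →L[ℂ] E)
    (hS : ∀ x, ι (A x) = S (ι x)) (e : OrthonormalBasis (Fin n) ℂ H) (j : ℕ) :
    ∑ i, (hA.eigenvalues hn i : ℂ) ^ j = ∑ i, inner ℂ (ι (e i)) ((S ^ j) (ι (e i))) := by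
  have h1 : ∀ x, ι ((A ^ j) x) = (S ^ j) (ι x) := by
    intro x
    induction j with
    | zero => rfl
    | succ j ih => rw [pow_succ', pow_succ', mul_apply_eq_comp, mul_apply_eq_comp, hS, ih]
  rw [← trace_eq_sum_of_eigenvectorBasis hA hn (A ^ j), LinearMap.trace_eq_sum_inner _ e]
  · refine Finset.sum_congr rfl fun i _ => ?_
    rw [← h1, ι.inner_map_map]
    rfl
  · intro i
    simpa using aeval_apply_of_apply_eq_smul (apply_eigenvectorBasis hA hn i) (Polynomial.X ^ j)

variable [CompleteSpace H]

lemma eigenvalues_mem_spectrum (hA : A.toLinearMap.IsSymmetric) (hn : Module.finrank ℂ H = n)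
    (i : Fin n) : (hA.eigenvalues hn i : ℂ) ∈ spectrum ℂ A := by
  rw [ContinuousLinearMap.spectrum_eq, ← Module.End.hasEigenvalue_iff_mem_spectrum]
  exact hA.hasEigenvalue_eigenvalues hn i

/-- The spectrum is finite, so that the functional calculus is polynomial interpolation. -/
lemma trace_applyFun (hA : A.toLinearMap.IsSymmetric) (hn : Module.finrank ℂ H = n) (ψ : ℝ → ℂ) :
    LinearMap.trace ℂ H (applyFun ψ A).toLinearMap = ∑ i, ψ (hA.eigenvalues hn i) := by
  have hfin : (spectrum ℂ A).Finite := by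
    rw [ContinuousLinearMap.spectrum_eq]
    exact Module.End.finite_spectrum _
  set p := Lagrange.interpolate hfin.toFinset id (fun z : ℂ => ψ z.re) with hp
  have h1 : Set.EqOn (fun z : ℂ => ψ z.re) (fun z => p.eval z) (spectrum ℂ A) := fun z hz =>
    (Lagrange.eval_interpolate_at_node (fun z : ℂ => ψ z.re) Function.injective_id.injOn
      (hfin.mem_toFinset.2 hz)).symm
  have hsa : IsSelfAdjoint A := ContinuousLinearMap.isSelfAdjoint_iff_isSymmetric.2 hA
  have h2 : applyFun ψ A = Polynomial.aeval A p := by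
    rw [applyFun, cfc_congr h1, cfc_polynomial p A hsa.isStarNormal]
  rw [h2]
  refine trace_eq_sum_of_eigenvectorBasis hA hn _ _ fun i => ?_
  rw [aeval_apply_of_apply_eq_smul (apply_eigenvectorBasis hA hn i)]
  congr 1
  exact (h1 (eigenvalues_mem_spectrum hA hn i)).symm

/-- The spectrum of a symmetric operator lies between any bounds of its quadratic form. -/
lemma spectrum_subset_Icc (hA : A.toLinearMap.IsSymmetric) {a b : ℝ}
    (ha : ∀ v, a * ‖v‖ ^ 2 ≤ (inner ℂ v (A v)).re) (hb : ∀ v, (inner ℂ v (A v)).re ≤ b * ‖v‖ ^ 2) :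
    spectrum ℂ A ⊆ Complex.ofReal '' Set.Icc a b := by
  intro z hz
  rw [ContinuousLinearMap.spectrum_eq, ← Module.End.hasEigenvalue_iff_mem_spectrum] at hz
  have hreal : (z.re : ℂ) = z := Complex.conj_eq_iff_re.1 (hA.conj_eigenvalue_eq_self hz)
  obtain ⟨v, hv⟩ := hz.exists_hasEigenvector
  have h1 : A v = z • v := hv.apply_eq_smul
  have h2 : 0 < ‖v‖ ^ 2 := by
    have := norm_pos_iff.2 hv.2
    positivity
  have h3 : (inner ℂ v (A v)).re = z.re * ‖v‖ ^ 2 := by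
    rw [h1, inner_smul_right, inner_self_eq_norm_sq_to_K, ← hreal]
    norm_cast
    exact Complex.re_ofReal_mul _ _
  have h4 := ha v
  have h5 := hb v
  rw [h3] at h4 h5
  exact ⟨z.re, ⟨le_of_mul_le_mul_right h4 h2, le_of_mul_le_mul_right h5 h2⟩, hreal⟩

end SymmetricOperator

/-! ### Eigenvalues of the compressions -/

lemma orthonormal_monomialK (N : ℕ) :
    Orthonormal ℂ fun k : Fin (N + 1) => monomialK (Nat.le_of_lt_succ k.2) :=
  ⟨fun k => orthonormal_monomial.1 k, fun _ _ hkl =>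
    orthonormal_monomial.2 fun h => hkl (Fin.ext h)⟩

/-- The orthonormal basis of `K_N` consisting of the normalized monomials. -/
def monomialBasis (N : ℕ) : OrthonormalBasis (Fin (N + 1)) ℂ (K N) :=
  OrthonormalBasis.mk (orthonormal_monomialK N)
    ((orthonormal_monomialK N).linearIndependent.span_eq_top_of_card_eq_finrank'
      (by rw [Fintype.card_fin, finrank_K])).ge

/-- The inclusion of `K_N` into `L²`. -/
def inclK (N : ℕ) : K N →ₗᵢ[ℂ] Lp ℂ 2 gaussian :=
  space.subtypeₗᵢ.comp (K N).subtypeₗᵢ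

lemma inclK_monomialBasis (N : ℕ) (k : Fin (N + 1)) :
    inclK N (monomialBasis N k) = monomial k := by
  rw [monomialBasis, OrthonormalBasis.coe_mk]
  rfl

lemma sum_eigenvalue_pow (hσ : MemLp σ ∞ gaussian) (N j : ℕ) :
    ∑ i, (eigenvalue σ hσ N i : ℂ) ^ j = ∑ m ∈ Finset.range (N + 1),
      inner ℂ (monomial m : Lp ℂ 2 gaussian)
        (((projK N ∘L mulOp (realSymbol σ hσ)) ^ j) (monomial m)) := by
  have h := sum_eigenvalues_pow (H := K N) (A := compression (realSymbol σ hσ) N)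
    (compression_isSymmetric σ hσ N) (finrank_K N) (inclK N)
    (projK N ∘L mulOp (realSymbol σ hσ)) (fun _ => rfl) (monomialBasis N) j
  simp only [inclK_monomialBasis] at h
  rw [Finset.sum_range]
  exact h

lemma traceFun_eq_sum (hσ : MemLp σ ∞ gaussian) (ψ : ℝ → ℂ) (N : ℕ) :
    traceFun σ hσ ψ N = ∑ i, ψ (eigenvalue σ hσ N i) := by
  have h := trace_applyFun (H := K N) (A := compression (realSymbol σ hσ) N)
    (compression_isSymmetric σ hσ N) (finrank_K N) ψ
  exact h

lemma inner_mulOp_mem_Icc (hσ : MemLp σ ∞ gaussian) (hs : IsRepresentative σ σt a b s)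
    (f : Lp ℂ 2 gaussian) :
    a * ‖f‖ ^ 2 ≤ (inner ℂ f (mulOp (realSymbol σ hσ) f)).re ∧
      (inner ℂ f (mulOp (realSymbol σ hσ) f)).re ≤ b * ‖f‖ ^ 2 := by
  have hf : Integrable (fun z => ‖f z‖ ^ 2) gaussian := (Lp.memLp f).norm.integrable_sq
  have hsm := hs.measurable
  have hi : Integrable (fun z => s z * ‖f z‖ ^ 2) gaussian :=
    hf.bdd_mul hsm.aestronglyMeasurable (.of_forall fun z => hs.abs_le z)
  have h1 : (inner ℂ f (mulOp (realSymbol σ hσ) f)).re = ∫ z, s z * ‖f z‖ ^ 2 ∂gaussian := by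
    rw [L2.inner_def, ← Complex.ofReal_re (∫ z, s z * ‖f z‖ ^ 2 ∂gaussian),
      ← integral_complex_ofReal]
    congr 1
    refine integral_congr_ae ?_
    filter_upwards [coeFn_mulOp_realSymbol hσ hs f] with z hz
    rw [hz, RCLike.inner_apply, mul_assoc, RCLike.mul_conj]
    push_cast
    rfl
  have h2 : ‖f‖ ^ 2 = ∫ z, ‖f z‖ ^ 2 ∂gaussian := by
    have h3 := congrArg Complex.re (L2.inner_def (𝕜 := ℂ) f f)
    rw [inner_self_eq_norm_sq_to_K] at h3
    have h4 : ∫ z, inner ℂ (f z) (f z) ∂gaussian = ((∫ z, ‖f z‖ ^ 2 ∂gaussian : ℝ) : ℂ) := by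
      rw [← integral_complex_ofReal]
      refine integral_congr_ae (.of_forall fun z => ?_)
      simp only [inner_self_eq_norm_sq_to_K]
      push_cast
      rfl
    rw [h4, Complex.ofReal_re] at h3
    rw [← h3]
    norm_cast
  rw [h1, h2, ← integral_const_mul, ← integral_const_mul]
  exact ⟨integral_mono (hf.const_mul a) hi fun z =>
      mul_le_mul_of_nonneg_right (hs.mem_Icc z).1 (by positivity),
    integral_mono hi (hf.const_mul b) fun z =>
      mul_le_mul_of_nonneg_right (hs.mem_Icc z).2 (by positivity)⟩

lemma spectrum_compression_subset (hσ : MemLp σ ∞ gaussian) (hs : IsRepresentative σ σt a b s)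
    (N : ℕ) :
    spectrum ℂ (compression (realSymbol σ hσ) N) ⊆ Complex.ofReal '' Set.Icc a b := by
  have h : ∀ v : K N, inner ℂ v (compression (realSymbol σ hσ) N v)
      = inner ℂ (inclK N v) (mulOp (realSymbol σ hσ) (inclK N v)) := fun v =>
    inner_projK N v _
  have h2 := spectrum_subset_Icc (H := K N) (A := compression (realSymbol σ hσ) N) (a := a) (b := b)
    (compression_isSymmetric σ hσ N)
  refine h2 (fun v => ?_) fun v => ?_
  · rw [h, ← (inclK N).norm_map]
    exact (inner_mulOp_mem_Icc hσ hs _).1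
  · rw [h, ← (inclK N).norm_map]
    exact (inner_mulOp_mem_Icc hσ hs _).2

lemma eigenvalue_mem_Icc (hσ : MemLp σ ∞ gaussian) (hs : IsRepresentative σ σt a b s) (N : ℕ)
    (i : Fin (N + 1)) : eigenvalue σ hσ N i ∈ Set.Icc a b := by
  have h1 := eigenvalues_mem_spectrum (H := K N) (A := compression (realSymbol σ hσ) N)
    (compression_isSymmetric σ hσ N) (finrank_K N) i
  obtain ⟨x, hx, h⟩ := spectrum_compression_subset hσ hs N h1
  have h2 : x = eigenvalue σ hσ N i := Complex.ofReal_injective h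
  rwa [← h2]

/-- The Szegő limit for monomials. -/
lemma tendsto_average_eigenvalue_pow (hσ : MemLp σ ∞ gaussian) (hs : IsRepresentative σ σt a b s)
    (j : ℕ) :
    Tendsto (fun N : ℕ => (N + 1 : ℂ)⁻¹ * ∑ i, (eigenvalue σ hσ N i : ℂ) ^ j) atTop
      (𝓝 (∫ θ, (σt θ : ℂ) ^ j ∂angular)) := by
  refine (tendsto_average_of_bulk (tendsto_inner_compression_pow hσ hs j)
    (norm_inner_compression_pow_le hσ j)).congr fun N => ?_
  rw [sum_eigenvalue_pow]

/-! ### The Szegő limit -/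

lemma integrable_comp_limit {E : Type*} [NormedAddCommGroup E] (hs : IsRepresentative σ σt a b s)
    {ψ : ℝ → E} (hψ : ContinuousOn ψ (Set.Icc a b)) : Integrable (fun θ => ψ (σt θ)) angular := by
  obtain ⟨θ₀, hθ₀⟩ := hs.ae_mem_Icc.exists
  have hab : a ≤ b := hθ₀.1.trans hθ₀.2
  obtain ⟨C, hC⟩ := isCompact_Icc.exists_bound_of_continuousOn hψ
  have h1 : Continuous (Set.IccExtend hab ((Set.Icc a b).domRestrict ψ)) :=
    (continuousOn_iff_continuous_domRestrict.1 hψ).Icc_extend'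
  have h2 : AEStronglyMeasurable (fun θ => ψ (σt θ)) angular := by
    refine (h1.comp_aestronglyMeasurable hs.aemeasurable.aestronglyMeasurable).congr ?_
    filter_upwards [hs.ae_mem_Icc] with θ hθ
    exact Set.IccExtend_of_mem hab _ hθ
  refine Integrable.of_bound h2 C ?_
  filter_upwards [hs.ae_mem_Icc] with θ hθ
  exact hC _ hθ

lemma tendsto_average_polynomial (hσ : MemLp σ ∞ gaussian) (hs : IsRepresentative σ σt a b s)
    (p : Polynomial ℝ) :
    Tendsto (fun N : ℕ => (N + 1 : ℝ)⁻¹ * ∑ i, p.eval (eigenvalue σ hσ N i)) atTop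
      (𝓝 (∫ θ, p.eval (σt θ) ∂angular)) := by
  induction p using Polynomial.induction_on' with
  | add p q hp hq =>
    simp only [Polynomial.eval_add, Finset.sum_add_distrib, mul_add]
    rw [integral_add (integrable_comp_limit hs p.continuous.continuousOn)
      (integrable_comp_limit hs q.continuous.continuousOn)]
    exact hp.add hq
  | monomial j c =>
    simp only [Polynomial.eval_monomial, ← Finset.mul_sum, integral_const_mul]
    have h1 := (Complex.continuous_re.tendsto _).comp (tendsto_average_eigenvalue_pow hσ hs j)
    have h2 : (∫ θ, (σt θ : ℂ) ^ j ∂angular).re = ∫ θ, σt θ ^ j ∂angular := by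
      rw [← Complex.ofReal_re (∫ θ, σt θ ^ j ∂angular), ← integral_complex_ofReal]
      simp only [Complex.ofReal_pow]
    rw [h2] at h1
    refine (h1.const_mul c).congr fun N => ?_
    have h3 : (N + 1 : ℂ)⁻¹ * ∑ i, (eigenvalue σ hσ N i : ℂ) ^ j
        = (((N + 1 : ℝ)⁻¹ * ∑ i, eigenvalue σ hσ N i ^ j : ℝ) : ℂ) := by
      push_cast
      rfl
    rw [Function.comp_apply, h3, Complex.ofReal_re]
    ring

lemma abs_average_sub_le {n : ℕ} {f g : Fin (n + 1) → ℝ} {ε : ℝ} (h : ∀ i, |f i - g i| ≤ ε) :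
    |(n + 1 : ℝ)⁻¹ * ∑ i, f i - (n + 1 : ℝ)⁻¹ * ∑ i, g i| ≤ ε := by
  have hn : (0 : ℝ) < n + 1 := by positivity
  rw [← mul_sub, ← Finset.sum_sub_distrib, abs_mul, abs_of_pos (inv_pos.2 hn), inv_mul_le_iff₀ hn]
  refine (Finset.abs_sum_le_sum_abs _ _).trans ((Finset.sum_le_sum fun i _ => h i).trans_eq ?_)
  simp

/-- The Szegő limit for real test functions, by Weierstrass approximation. -/
lemma tendsto_average_real (hσ : MemLp σ ∞ gaussian) (hs : IsRepresentative σ σt a b s)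
    {ψ : ℝ → ℝ} (hψ : ContinuousOn ψ (Set.Icc a b)) :
    Tendsto (fun N : ℕ => (N + 1 : ℝ)⁻¹ * ∑ i, ψ (eigenvalue σ hσ N i)) atTop
      (𝓝 (∫ θ, ψ (σt θ) ∂angular)) := by
  rw [Metric.tendsto_nhds]
  intro ε hε
  obtain ⟨p, hp⟩ := exists_polynomial_near_of_continuousOn a b ψ hψ (ε / 3) (by positivity)
  have h1 : |∫ θ, p.eval (σt θ) ∂angular - ∫ θ, ψ (σt θ) ∂angular| ≤ ε / 3 := by
    rw [← integral_sub (integrable_comp_limit hs p.continuous.continuousOn)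
      (integrable_comp_limit hs hψ), ← Real.norm_eq_abs]
    refine (norm_integral_le_of_norm_le_const (C := ε / 3) ?_).trans_eq (by simp)
    filter_upwards [hs.ae_mem_Icc] with θ hθ
    exact (hp _ hθ).le
  filter_upwards [Metric.tendsto_nhds.1 (tendsto_average_polynomial hσ hs p) (ε / 3)
    (by positivity)] with N h2
  have h3 := abs_average_sub_le (n := N) (f := fun i => p.eval (eigenvalue σ hσ N i))
    (g := fun i => ψ (eigenvalue σ hσ N i)) fun i => (hp _ (eigenvalue_mem_Icc hσ hs N i)).le
  rw [Real.dist_eq] at h2 ⊢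
  rw [abs_le] at h1 h3
  rw [abs_lt] at h2 ⊢
  constructor <;> linarith [h1.1, h1.2, h2.1, h2.2, h3.1, h3.2]

lemma tendsto_average_complex (hσ : MemLp σ ∞ gaussian) (hs : IsRepresentative σ σt a b s)
    {ψ : ℝ → ℂ} (hψ : ContinuousOn ψ (Set.Icc a b)) :
    Tendsto (fun N : ℕ => (N + 1 : ℂ)⁻¹ * ∑ i, ψ (eigenvalue σ hσ N i)) atTop
      (𝓝 (∫ θ, ψ (σt θ) ∂angular)) := by
  have h1 := tendsto_average_real hσ hs (Complex.continuous_re.comp_continuousOn hψ)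
  have h2 := tendsto_average_real hσ hs (Complex.continuous_im.comp_continuousOn hψ)
  have h3 := ((Complex.continuous_ofReal.tendsto _).comp h1).add
    (((Complex.continuous_ofReal.tendsto _).comp h2).mul_const Complex.I)
  have h4 := integral_re_add_im (integrable_comp_limit hs hψ)
  simp only [RCLike.re_eq_complex_re, RCLike.im_eq_complex_im, RCLike.I_to_complex] at h4
  rw [← h4]
  refine h3.congr fun N => ?_
  simp only [Function.comp_apply]
  push_cast
  rw [mul_assoc, ← mul_add, Finset.sum_mul, ← Finset.sum_add_distrib]
  simp only [Complex.re_add_im]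

/-! ### The density of eigenvalues -/

/-- The normalized eigenvalue counting measure of the compression to `K_N`. -/
def eigenvalueMeasure (σ : ℂ → ℝ) (hσ : MemLp σ ∞ gaussian) (N : ℕ) : Measure ℝ :=
  ENNReal.ofReal (N + 1 : ℝ)⁻¹ • ∑ i, Measure.dirac (eigenvalue σ hσ N i)

instance (hσ : MemLp σ ∞ gaussian) (N : ℕ) : IsProbabilityMeasure (eigenvalueMeasure σ hσ N) := by
  constructor
  have h1 : ((N : ℝ≥0∞) + 1) = ENNReal.ofReal (N + 1 : ℝ) := by
    rw [ENNReal.ofReal_add (by positivity) zero_le_one, ENNReal.ofReal_natCast, ENNReal.ofReal_one]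
  simp only [eigenvalueMeasure, Measure.smul_apply, Measure.finsetSum_apply, measure_univ,
    Finset.sum_const, Finset.card_univ, Fintype.card_fin, nsmul_eq_mul, smul_eq_mul, mul_one]
  rw [Nat.cast_succ, h1, ← ENNReal.ofReal_mul (by positivity), inv_mul_cancel₀ (by positivity),
    ENNReal.ofReal_one]

lemma integral_eigenvalueMeasure (hσ : MemLp σ ∞ gaussian) (N : ℕ) (f : ℝ → ℝ) :
    ∫ x, f x ∂eigenvalueMeasure σ hσ N = (N + 1 : ℝ)⁻¹ * ∑ i, f (eigenvalue σ hσ N i) := by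
  rw [eigenvalueMeasure, integral_smul_measure, ENNReal.toReal_ofReal (by positivity),
    integral_finsetSum_measure fun i _ => integrable_dirac (by finiteness)]
  simp only [integral_dirac, smul_eq_mul]

lemma eigenvalueMeasure_real (hσ : MemLp σ ∞ gaussian) (N : ℕ) {S : Set ℝ} (hS : MeasurableSet S) :
    (eigenvalueMeasure σ hσ N).real S
      = (Nat.card {i : Fin (N + 1) // eigenvalue σ hσ N i ∈ S} : ℝ) / (N + 1) := by
  classical
  have h := integral_eigenvalueMeasure hσ N (S.indicator 1)
  rw [integral_indicator_one hS] at h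
  rw [h, Nat.card_eq_fintype_card, Fintype.card_subtype, div_eq_inv_mul]
  congr 1
  simp only [Set.indicator_apply, Pi.one_apply, Finset.sum_boole]

lemma angular_real (S : Set ℝ) :
    angular.real S
      = (volume {θ : ℝ | θ ∈ Set.Ico 0 (2 * Real.pi) ∧ θ ∈ S}).toReal / (2 * Real.pi) := by
  rw [measureReal_def, angular, ← restrict_Ioo_eq_restrict_Ioc, restrict_Ioo_eq_restrict_Ico,
    Measure.smul_apply, Measure.restrict_apply' measurableSet_Ico, smul_eq_mul, ENNReal.toReal_mul,
    ENNReal.toReal_ofReal (by positivity), div_eq_inv_mul, Set.inter_comm]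
  rfl

/-- The eigenvalue counting measures converge weakly to the distribution of `σt`, so that they
converge on intervals whose end points are not charged. -/
lemma tendsto_card_eigenvalue_div (hσ : MemLp σ ∞ gaussian) (hs : IsRepresentative σ σt a b s)
    {α β : ℝ} (hα : angular.real {θ | σt θ = α} = 0) (hβ : angular.real {θ | σt θ = β} = 0) :
    Tendsto (fun N : ℕ => (Nat.card {i : Fin (N + 1) // eigenvalue σ hσ N i ∈ Set.Ioo α β} : ℝ)
      / (N + 1)) atTop (𝓝 (angular.real {θ | σt θ ∈ Set.Ioo α β})) := by
  have hm := hs.aemeasurable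
  let ν : ProbabilityMeasure ℝ := ⟨angular.map σt, Measure.isProbabilityMeasure_map hm⟩
  let νs : ℕ → ProbabilityMeasure ℝ := fun N => ⟨eigenvalueMeasure σ hσ N, inferInstance⟩
  have hlim : Tendsto νs atTop (𝓝 ν) := by
    rw [ProbabilityMeasure.tendsto_iff_forall_integral_tendsto]
    intro f
    have h1 := tendsto_average_real hσ hs f.continuous.continuousOn
    rw [← integral_map hm f.continuous.aestronglyMeasurable] at h1
    refine h1.congr fun N => ?_
    rw [← integral_eigenvalueMeasure]
    rfl
  have hnull : (ν : Measure ℝ) (frontier (Set.Ioo α β)) = 0 := by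
    refine measure_mono_null (t := {α, β}) ?_ ?_
    · intro x hx
      rcases lt_or_ge α β with h | h
      · rwa [frontier_Ioo h] at hx
      · rw [Set.Ioo_eq_empty (not_lt.2 h), frontier_empty] at hx
        exact hx.elim
    · rw [Set.insert_eq]
      have h2 : ∀ x, angular.real {θ | σt θ = x} = 0 → (ν : Measure ℝ) {x} = 0 := fun x hx => by
        rw [measureReal_eq_zero_iff] at hx
        change angular.map σt {x} = 0
        rw [Measure.map_apply_of_aemeasurable hm (measurableSet_singleton x)]
        exact hx
      exact measure_union_null (h2 α hα) (h2 β hβ)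
  have h3 := ProbabilityMeasure.tendsto_measure_of_null_frontier_of_tendsto' hlim hnull
  have h4 := (ENNReal.tendsto_toReal (measure_ne_top (ν : Measure ℝ) (Set.Ioo α β))).comp h3
  have h5 : ((ν : Measure ℝ) (Set.Ioo α β)).toReal = angular.real {θ | σt θ ∈ Set.Ioo α β} := by
    change (angular.map σt (Set.Ioo α β)).toReal = _
    rw [Measure.map_apply_of_aemeasurable hm measurableSet_Ioo]
    rfl
  rw [h5] at h4
  refine h4.congr fun N => ?_
  rw [← eigenvalueMeasure_real hσ N measurableSet_Ioo]
  rfl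

end Fock

end

theorem mainTheorem5 :
    -- the moments of the Fock space, `R = ∞`, and the moment-ratio condition
    (∀ n : ℕ, Fock.moment (2 * n + 1) = (n ! : ℝ)) ∧
    Tendsto (fun n : ℕ => Fock.moment (n + 1) / Fock.moment n) atTop atTop ∧
    (∀ m : ℕ, Tendsto (fun l : ℕ => Fock.moment (2 * l + m + 1) /
        (√(Fock.moment (2 * l + 2 * m + 1)) * √(Fock.moment (2 * l + 1)))) atTop (𝓝 1)) ∧
    ∀ (σ : ℂ → ℝ) (hσ : MemLp σ ∞ Fock.gaussian) (σt : ℝ → ℝ), Fock.HasRadialLimit σ σt →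
      -- the spectra lie in the interval on which `ψ` lives, so `ψ(P_N T_σ P_N)` makes sense
      (∀ (N : ℕ), spectrum ℂ (Fock.compression (Fock.realSymbol σ hσ) N) ⊆
        Complex.ofReal '' Set.Icc (essInf σ Fock.gaussian) (essSup σ Fock.gaussian)) ∧
      -- the Szegő limit
      (∀ ψ : ℝ → ℂ,
        ContinuousOn ψ (Set.Icc (essInf σ Fock.gaussian) (essSup σ Fock.gaussian)) →
        IntervalIntegrable (fun θ => ψ (σt θ)) volume 0 (2 * Real.pi) ∧
        Tendsto (fun N : ℕ => (1 / (N + 1 : ℂ)) * Fock.traceFun σ hσ ψ N) atTop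
          (𝓝 ((1 / (2 * Real.pi : ℂ)) * ∫ θ in (0 : ℝ)..(2 * Real.pi), ψ (σt θ)))) ∧
      -- the density of eigenvalues
      (∀ α β : ℝ, α ∈ Set.Ioo (essInf σ Fock.gaussian) (essSup σ Fock.gaussian) →
        β ∈ Set.Ioo (essInf σ Fock.gaussian) (essSup σ Fock.gaussian) →
        α < β → (0 < α ∨ β < 0) →
        volume {θ : ℝ | θ ∈ Set.Ico 0 (2 * Real.pi) ∧ σt θ = α} = 0 →
        volume {θ : ℝ | θ ∈ Set.Ico 0 (2 * Real.pi) ∧ σt θ = β} = 0 →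
        Tendsto (fun N : ℕ =>
            (Nat.card {j : Fin (N + 1) // α < Fock.eigenvalue σ hσ N j ∧
              Fock.eigenvalue σ hσ N j < β} : ℝ) / (N + 1)) atTop
          (𝓝 ((volume {θ : ℝ | θ ∈ Set.Ico 0 (2 * Real.pi) ∧ α < σt θ ∧ σt θ < β}).toReal /
            (2 * Real.pi)))) := by
  refine ⟨Fock.moment_two_mul_add_one, Fock.tendsto_momentRatio_atTop, fun m => ?_,
    fun σ hσ σt hlim => ?_⟩
  · refine ((Fock.tendsto_moment_sq_div m).comp (tendsto_atTop_mono (f := id)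
      (g := fun l => 2 * l + 1) (fun l => by simp only [id]; omega) tendsto_id)).congr fun l => ?_
    simp only [Function.comp_apply]
    rw [show 2 * l + 1 + m = 2 * l + m + 1 by ring,
      show 2 * l + 1 + 2 * m = 2 * l + 2 * m + 1 by ring]
  · obtain ⟨s, hs⟩ := Fock.exists_isRepresentative hσ hlim
    refine ⟨Fock.spectrum_compression_subset hσ hs, fun ψ hψ => ⟨?_, ?_⟩,
      fun α β _ _ _ _ hα hβ => ?_⟩
    · have h := Fock.integrable_comp_limit hs hψ
      rw [intervalIntegrable_iff_integrableOn_Ioc_of_le Real.two_pi_pos.le]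
      rwa [Fock.angular, integrable_smul_measure (by simp [Real.pi_pos])
        ENNReal.ofReal_ne_top] at h
    · have h := Fock.tendsto_average_complex hσ hs hψ
      rw [Fock.integral_angular, Complex.real_smul] at h
      simp only [Fock.traceFun_eq_sum, one_div]
      convert h using 3
      push_cast
      rfl
    · have h0 : ∀ x, volume {θ : ℝ | θ ∈ Set.Ico 0 (2 * Real.pi) ∧ σt θ = x} = 0 →
          Fock.angular.real {θ | σt θ = x} = 0 := fun x hx => by
        have hx' : volume {θ : ℝ | θ ∈ Set.Ico 0 (2 * Real.pi) ∧ θ ∈ {θ | σt θ = x}} = 0 := hx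
        rw [Fock.angular_real, hx', ENNReal.toReal_zero, zero_div]
      have h := Fock.tendsto_card_eigenvalue_div hσ hs (h0 α hα) (h0 β hβ)
      rw [Fock.angular_real] at h
      exact h
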